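/- **Theorem 3.5.** Call two subgroups $H_1,H_2$ of a finite group $G$ *solvably equivalent* if there is a bijection from the set of solvable subgroups of $H_1$ to the set of solvable subgroups of $H_2$ that maps every subgroup to a $G$-conjugate of itself. Let $p$ be a prime with $p\equiv \pm 29 \pmod{120}$. Then there are subgroups $H_1,H_2$ of $\mathrm{SL}_2(\mathbf F_p)$ and a nonsquare $r\in\mathbf F_p^\times$ such that, with $\sigma=\begin{pmatrix} r&0\\0&1\end{pmatrix}\in\mathrm{GL}_2(\mathbf F_p)$: 1. $H_2=\sigma H_1\sigma^{-1}$, and $H_1$ and $H_2$ are isomorphic to $\mathrm{SL}_2(\mathbf F_5)$; 2. $H_1$ and $H_2$ are solvably equivalent subgroups of $\mathrm{SL}_2(\mathbf F_p)$ that are not conjugate in $\mathrm{SL}_2(\mathbf F_p)$; 3. the images of $H_1$ and $H_2$ in $\mathrm{PSL}_2(\mathbf F_p)$ are solvably equivalent subgroups of $\mathrm{PSL}_2(\mathbf F_p)$ that are not conjugate in $\mathrm{PSL}_2(\mathbf F_p)$, and both images are isomorphic to the alternating group $A_5$. The prime $p=29$ satisfies the congruence (Scott's example), there are infinitely many primes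 $p\equiv\pm29\pmod{120}$, and for distinct such primes $p\ne q$ we have $\mathrm{SL}_2(\mathbf F_p)\not\simeq\mathrm{SL}_2(\mathbf F_q)$ and $\mathrm{PSL}_2(\mathbf F_p)\not\simeq\mathrm{PSL}_2(\mathbf F_q)$; so this gives infinitely many distinct examples of solvable equivalence. -/

import Mathlib

/-- Two subgroups `H₁`, `H₂` of a group `G` are `G`-conjugate: `H₂ = g H₁ g⁻¹` for some `g` in `G`. -/
def ConjugateSubgroups {G : Type*} [Group G] (H₁ H₂ : Subgroup G) : Prop :=
  ∃ g : G, H₂ = H₁.map (MulAut.conj g).toMonoidHom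

/-- The set of solvable subgroups of `H`, viewed as subgroups of the ambient group `G`. -/
def solvableSubgroups {G : Type*} [Group G] (H : Subgroup G) : Set (Subgroup G) :=
  {K | K ≤ H ∧ Group.IsSolvable K}

/-- Two subgroups `H₁`, `H₂` of a finite group `G` are solvably equivalent if there is a bijection
from the set of solvable subgroups of `H₁` to the set of solvable subgroups of `H₂` that maps each
subgroup to a `G`-conjugate of itself. -/
def SolvablyEquivalent {G : Type*} [Group G] [Finite G] (H₁ H₂ : Subgroup G) : Prop :=
  ∃ e : solvableSubgroups H₁ ≃ solvableSubgroups H₂,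
    ∀ K : solvableSubgroups H₁, ConjugateSubgroups (K : Subgroup G) (e K : Subgroup G)

/-- The image in `PSL₂(F_p) = SL₂(F_p) / center` of a subgroup of `SL₂(F_p)`. -/
def projectiveImage {p : ℕ} (H : Subgroup (Matrix.SpecialLinearGroup (Fin 2) (ZMod p))) :
    Subgroup (Matrix.ProjectiveSpecialLinearGroup (Fin 2) (ZMod p)) :=
  H.map (QuotientGroup.mk'
    (Subgroup.center (Matrix.SpecialLinearGroup (Fin 2) (ZMod p))))

instance finiteSL2 (p : ℕ) [Fact p.Prime] :
    Finite (Matrix.SpecialLinearGroup (Fin 2) (ZMod p)) :=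
  Subtype.finite

instance finitePSL2 (p : ℕ) [Fact p.Prime] :
    Finite (Matrix.ProjectiveSpecialLinearGroup (Fin 2) (ZMod p)) :=
  Quotient.finite _

/-- The primes congruent to `29` or `-29` modulo `120`. -/
def scottPrimes : Set ℕ :=
  {p | p.Prime ∧ ((p : ℤ) ≡ 29 [ZMOD 120] ∨ (p : ℤ) ≡ -29 [ZMOD 120])}

/-!
Write `H₁` for a copy of `SL₂(F₅)` in `SL₂(F_p)` and `H₂ = σ H₁ σ⁻¹`, where `det σ = r` is not a
square. Conjugation by a matrix `m` of `GL₂(F_p)` is an inner automorphism of `SL₂(F_p)` when `det m`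
is a square. So a subgroup `K` of `H₁` is conjugate in `SL₂(F_p)` to `σ K σ⁻¹` as soon as some
matrix of nonsquare determinant normalizes `K`, and only then.

*Solvable subgroups.* The elements of `H₁` have order `1`, `2`, `3` or `5` modulo `±1`. If `K ≤ H₁` is
solvable and not central, it has a noncentral normal subgroup `A` that is commutative modulo `±1`.
Either `K` normalizes `⟨x⟩` up to sign for some `x` of order `4`, `3` or `5`, and then `1 - x`
normalizes `K`; or `A` is a quaternion group containing some `i` with `i² = -1`, whose axes `K`
permutes cyclically, and then `1 + i` normalizes `K`
(`exists_conjSL_of_odd_order`, `exists_conjSL_of_quaternion`, `exists_conjSL_of_isSolvable`).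
The determinants are `2 - tr x ∈ {2, 3, 2 - t}`, with `t² + t - 1 = 0`, and `2`. The congruence
`p ≡ ±29 mod 120` makes all of them nonsquares
(`two_sub_golden_root_not_isSquare` for the last one), so `K ↦ σ K σ⁻¹` is a solvable equivalence.

*Nonconjugacy.* A matrix normalizing `H₁` induces an automorphism of `SL₂(F₅)` that preserves traces
in `F_p`. An outer automorphism would exchange the two classes of elements of order five, whose
traces are the two distinct roots of `t² + t - 1`. The automorphism is therefore inner, the matrix is
a scalar multiple of an element of `H₁`, and its determinant is a square
(`isSquare_det_of_normalizes`).

*Passage to `PSL₂`.* Both groups contain the center, and central extensions of solvable groups are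
solvable, so both statements descend (`solvablyEquivalent_map_center`,
`conjugateSubgroups_of_map_mk'`).

*Existence.* `SL₂(F₅)` is presented by the relations between its Bruhat generators
(`BruhatRelations.hom`). Solutions in `SL₂(F_p)` come from a point on a conic
(`exists_conic_point`, `bruhatRelations_of_conic`), and solutions in the alternating group
(`bruhatRelations_perm`) give `PSL₂(F₅) ≃ A₅`. The groups for different primes are distinguished by
their orders, and the primes are infinite in number by Dirichlet's theorem.
-/

open scoped MatrixGroups
open Matrix

/-! ### Quadratic residues modulo a prime congruent to `±29` modulo `120` -/

lemma scott_mod {p : ℕ} (h : (p : ℤ) ≡ 29 [ZMOD 120] ∨ (p : ℤ) ≡ -29 [ZMOD 120]) :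
    p % 120 = 29 ∨ p % 120 = 91 := by
  unfold Int.ModEq at h
  omega

lemma two_not_isSquare {p : ℕ} [Fact p.Prime] (h : p % 120 = 29 ∨ p % 120 = 91) :
    ¬ IsSquare (2 : ZMod p) := by
  rw [ZMod.exists_sq_eq_two_iff (by omega)]
  omega

lemma three_not_isSquare {p : ℕ} [Fact p.Prime] (h : p % 120 = 29 ∨ p % 120 = 91) :
    ¬ IsSquare (3 : ZMod p) := by
  have h2 : ¬ IsSquare (2 : ZMod 3) := by decide
  have : Fact (Nat.Prime 3) := ⟨Nat.prime_three⟩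
  rcases h with h | h
  · have := ZMod.exists_sq_eq_prime_iff_of_mod_four_eq_one (p := p) (q := 3) (by omega) (by omega)
    rw [Nat.cast_ofNat] at this
    rw [this, ← ZMod.natCast_mod p 3, show p % 3 = 2 by omega]
    exact h2
  · have := ZMod.exists_sq_eq_prime_iff_of_mod_four_eq_three (p := p) (q := 3) (by omega)
      (by omega) (by omega)
    rw [Nat.cast_ofNat] at this
    rw [this, not_not, ← ZMod.natCast_mod p 3, show p % 3 = 1 by omega, Nat.cast_one]
    exact IsSquare.one

lemma five_isSquare {p : ℕ} [Fact p.Prime] (h : p % 120 = 29 ∨ p % 120 = 91) :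
    IsSquare (5 : ZMod p) := by
  have h4 : IsSquare (4 : ZMod 5) := by decide
  have : Fact (Nat.Prime 5) := ⟨Nat.prime_five⟩
  have := ZMod.exists_sq_eq_prime_iff_of_mod_four_eq_one (p := 5) (q := p) (by omega) (by omega)
  rw [Nat.cast_ofNat] at this
  rw [← this, ← ZMod.natCast_mod p 5]
  rcases h with h | h
  · rw [show p % 5 = 4 by omega]; exact h4
  · rw [show p % 5 = 1 by omega, Nat.cast_one]; exact IsSquare.one

lemma natCast_ne_zero_of_lt {p : ℕ} [Fact p.Prime] {n : ℕ} (h0 : n ≠ 0) (h : n < p) :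
    (n : ZMod p) ≠ 0 := by
  rw [Ne, ZMod.natCast_eq_zero_iff]
  exact fun hd => absurd (Nat.le_of_dvd (Nat.pos_of_ne_zero h0) hd) (by omega)

/-- The polynomial `t² + t - 1`, whose roots are the traces of the elements of order five
in `SL₂`, splits over `F_p`. -/
lemma exists_golden_root {p : ℕ} [Fact p.Prime] (h : p % 120 = 29 ∨ p % 120 = 91) :
    ∃ t : ZMod p, t ^ 2 + t - 1 = 0 := by
  obtain ⟨s, hs⟩ := five_isSquare h
  have h2 : (2 : ZMod p) ≠ 0 := by
    exact_mod_cast natCast_ne_zero_of_lt (p := p) (n := 2) (by omega) (by omega)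
  refine ⟨(s - 1) / 2, ?_⟩
  field_simp
  linear_combination -hs

lemma five_dvd_sub_one {p : ℕ} [Fact p.Prime] {z : ZMod p} (hz : z ^ 5 = 1) (hz1 : z ≠ 1) :
    5 ∣ p - 1 := by
  have : Fact (Nat.Prime 5) := ⟨Nat.prime_five⟩
  have h0 : z ≠ 0 := by rintro rfl; simp at hz
  have := orderOf_eq_prime hz hz1
  rw [← this]
  exact orderOf_dvd_of_pow_eq_one (ZMod.pow_card_sub_one_eq_one h0)

/-- The determinant `2 - t` of `1 - x`, for `x` of order five and trace `t`, is not a square.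
The discriminant of the characteristic polynomial of `x` is `-(2 - t) (1 + t)²`, so `-(2 - t)` is
a square exactly when `F_p` contains the fifth roots of unity. This happens for `p ≡ 1 mod 5`,
where `-1` is not a square, and fails for `p ≡ -1 mod 5`, where `-1` is a square. -/
lemma two_sub_golden_root_not_isSquare {p : ℕ} [Fact p.Prime] (h : p % 120 = 29 ∨ p % 120 = 91)
    {t : ZMod p} (ht : t ^ 2 + t - 1 = 0) : ¬ IsSquare (2 - t) := by
  have h2 : (2 : ZMod p) ≠ 0 := by
    exact_mod_cast natCast_ne_zero_of_lt (p := p) (n := 2) (by omega) (by omega)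
  have h5 : (5 : ZMod p) ≠ 0 := by
    exact_mod_cast natCast_ne_zero_of_lt (p := p) (n := 5) (by omega) (by omega)
  rintro ⟨s, hs⟩
  rcases h with h | h
  · obtain ⟨i, hi⟩ := (ZMod.exists_sq_eq_neg_one_iff (p := p)).2 (by omega)
    have hd : (i * s * (1 + t)) ^ 2 = t ^ 2 - 4 := by
      grind
    -- `z` is a root of `z² - t z + 1`, hence a fifth root of unity
    obtain ⟨z, hz⟩ : ∃ z : ZMod p, z ^ 2 - t * z + 1 = 0 :=
      ⟨(t + i * s * (1 + t)) / 2, by field_simp; linear_combination hd⟩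
    have hz5 : z ^ 5 = 1 := by
      grind
    have hz1 : z ≠ 1 := by
      rintro rfl
      apply h5
      grind
    have := five_dvd_sub_one hz5 hz1
    omega
  · have hm : ¬ IsSquare (-1 : ZMod p) := by
      rw [ZMod.exists_sq_eq_neg_one_iff]; omega
    obtain ⟨z, hz⟩ : ∃ z : (ZMod p)ˣ, orderOf z = 5 := by
      obtain ⟨g, hg⟩ := IsCyclic.exists_ofOrder_eq_natCard (α := (ZMod p)ˣ)
      refine ⟨g ^ ((p - 1) / 5), ?_⟩
      rw [Nat.card_eq_fintype_card, ZMod.card_units_eq_totient, Nat.totient_prime Fact.out] at hg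
      rw [orderOf_pow_of_dvd (by omega) (by rw [hg]; exact Nat.div_dvd_of_dvd (by omega)), hg]
      exact Nat.div_div_self (by omega) (by omega)
    have hz5 : (z : ZMod p) ^ 5 = 1 := by
      rw [← Units.val_pow_eq_pow_val, ← hz, pow_orderOf_eq_one, Units.val_one]
    have hz1 : (z : ZMod p) ≠ 1 := by
      intro h1
      rw [Units.val_eq_one.1 h1, orderOf_one] at hz
      omega
    generalize (z : ZMod p) = y at hz5 hz1
    have hy0 : y ≠ 0 := by rintro rfl; simp at hz5
    have hc : y ^ 4 + y ^ 3 + y ^ 2 + y + 1 = 0 := by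
      apply mul_left_cancel₀ (sub_ne_zero.2 hz1)
      linear_combination hz5
    have key : ∀ x : ZMod p, x ^ 5 = 1 → x ≠ 1 → x ^ 2 - t * x + 1 = 0 → False := by
      intro x hx5 hx1 hx
      have hx0 : x ≠ 0 := by rintro rfl; simp at hx5
      have hs0 : s ≠ 0 := by
        rintro rfl
        apply h5
        grind
      have ht1 : 1 + t ≠ 0 := by
        intro h1
        apply one_ne_zero (α := ZMod p)
        grind
      apply hm
      refine ⟨(x ^ 2 - 1) / (x * s * (1 + t)), ?_⟩
      field_simp
      grind
    have hf : (y ^ 2 - t * y + 1) * (y ^ 4 - t * y ^ 2 + 1) = 0 := by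
      grind
    rcases mul_eq_zero.1 hf with h1 | h1
    · exact key y hz5 hz1 h1
    · refine key (y ^ 2) ?_ ?_ ?_
      · grind
      · intro h3
        apply hz1
        grind
      · linear_combination h1

/-! ### A presentation of `SL₂(F₅)` -/

section
variable {F : Type*} [Field F]

lemma sl_coe_injective {g k : SL(2, F)}
    (h : (g : Matrix (Fin 2) (Fin 2) F) = (k : Matrix (Fin 2) (Fin 2) F)) : g = k :=
  Subtype.ext h

lemma sl_det_eq (g : SL(2, F)) : g 0 0 * g 1 1 - g 0 1 * g 1 0 = 1 := by
  rw [← Matrix.det_fin_two]; exact g.2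

lemma sl_coe_eq (g : SL(2, F)) : (g : Matrix (Fin 2) (Fin 2) F) = !![g 0 0, g 0 1; g 1 0, g 1 1] :=
  Matrix.eta_fin_two _
end

namespace BruhatRelations

/-- The discrete logarithm to the base `2` modulo `5`, with the junk value `0` at `0`. -/
def log (m : ZMod 5) : ℕ := ![0, 0, 1, 3, 2] m

end BruhatRelations

open BruhatRelations in
/-- The relations between the Bruhat generators of `SL₂(F₅)`, imposed on elements `X`, `W`, `D` of
a group `G`: they stand for the matrices `[[1, 1], [0, 1]]`, `[[0, -1], [1, 0]]` and `diag(2, 3)`.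
The torus element `diag(m, m⁻¹)` of `SL₂(F₅)` is represented by `D ^ log m`. -/
structure BruhatRelations {G : Type*} [Group G] (X W D : G) : Prop where
  pow_five : X ^ 5 = 1
  pow_four : D ^ 4 = 1
  sq_eq : W ^ 2 = D ^ 2
  torus_conj : D * X = X ^ 4 * D
  big_cell : ∀ m n : ZMod 5, m * n = -1 → W * X ^ m.val * W = X ^ n.val * W * D ^ log m * X ^ n.val

instance fact_prime_five : Fact (Nat.Prime 5) := ⟨Nat.prime_five⟩

namespace BruhatRelations

variable {G : Type*} [Group G] {X W D : G}

lemma pow_eq_of_mod_five (h : BruhatRelations X W D) {m n : ℕ} (hmn : m % 5 = n % 5) :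
    X ^ m = X ^ n := by
  rw [← pow_mod_orderOf X m, ← pow_mod_orderOf X n]
  have hd : orderOf X ∣ 5 := orderOf_dvd_of_pow_eq_one h.pow_five
  congr 1
  exact Nat.ModEq.of_dvd hd hmn

lemma pow_eq_of_mod_four (h : BruhatRelations X W D) {m n : ℕ} (hmn : m % 4 = n % 4) :
    D ^ m = D ^ n := by
  rw [← pow_mod_orderOf D m, ← pow_mod_orderOf D n]
  have hd : orderOf D ∣ 4 := orderOf_dvd_of_pow_eq_one h.pow_four
  congr 1
  exact Nat.ModEq.of_dvd hd hmn

lemma unipotent_mul (h : BruhatRelations X W D) (a b : ZMod 5) :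
    X ^ a.val * X ^ b.val = X ^ (a + b).val := by
  rw [← pow_add]
  apply h.pow_eq_of_mod_five
  rw [ZMod.val_add, Nat.mod_mod]

lemma torus_mul (h : BruhatRelations X W D) {a b : ZMod 5} (ha : a ≠ 0) (hb : b ≠ 0) :
    D ^ log a * D ^ log b = D ^ log (a * b) := by
  rw [← pow_add]
  apply h.pow_eq_of_mod_four
  revert a b
  decide

lemma torus_mul_unipotent (h : BruhatRelations X W D) {a : ZMod 5} (ha : a ≠ 0) (b : ZMod 5) :
    D ^ log a * X ^ b.val = X ^ (a ^ 2 * b).val * D ^ log a := by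
  have key : ∀ k n : ℕ, D ^ k * X ^ n = X ^ (4 ^ k * n) * D ^ k := by
    intro k
    induction k with
    | zero => intro n; simp
    | succ k ih =>
      intro n
      have h1 : D * X ^ n = X ^ (4 * n) * D := by
        rw [pow_mul]
        exact SemiconjBy.pow_right (show SemiconjBy D X (X ^ 4) from h.torus_conj) n
      rw [pow_succ, mul_assoc, h1, ← mul_assoc, ih, mul_assoc, pow_succ, mul_assoc (4 ^ k)]
  rw [key]
  congr 1
  apply h.pow_eq_of_mod_five
  revert a b
  decide

lemma weyl_mul_weyl (h : BruhatRelations X W D) : W * W = D ^ log (-1) := by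
  rw [← sq, h.sq_eq]; rfl

variable (X W D) in
/-- The map `SL₂(F₅) → G` given by the Bruhat normal form: upper triangular matrices are written
as torus times unipotent, and the others as unipotent times Weyl element times torus times
unipotent. -/
def bruhat (g : SL(2, ZMod 5)) : G :=
  if g 1 0 = 0 then D ^ log (g 0 0) * X ^ ((g 0 0)⁻¹ * g 0 1).val
  else X ^ (g 0 0 * (g 1 0)⁻¹).val * W * D ^ log (g 1 0) * X ^ (g 1 1 * (g 1 0)⁻¹).val

/-- The unipotent generator of `SL₂(F₅)`. -/
def unip : SL(2, ZMod 5) := ⟨!![1, 1; 0, 1], by simp⟩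

/-- The Weyl element of `SL₂(F₅)`. -/
def weyl : SL(2, ZMod 5) := ⟨!![0, -1; 1, 0], by simp⟩

lemma coe_unip : (unip : Matrix (Fin 2) (Fin 2) (ZMod 5)) = !![1, 1; 0, 1] := rfl

lemma coe_weyl : (weyl : Matrix (Fin 2) (Fin 2) (ZMod 5)) = !![0, -1; 1, 0] := rfl

lemma bruhat_unip_mul (h : BruhatRelations X W D) (g : SL(2, ZMod 5)) :
    bruhat X W D (unip * g) = X * bruhat X W D g := by
  have h00 : (unip * g) 0 0 = g 0 0 + g 1 0 := by
    simp [coe_unip, Matrix.mul_apply, Fin.sum_univ_two]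
  have h01 : (unip * g) 0 1 = g 0 1 + g 1 1 := by
    simp [coe_unip, Matrix.mul_apply, Fin.sum_univ_two]
  have h10 : (unip * g) 1 0 = g 1 0 := by simp [coe_unip, Matrix.mul_apply, Fin.sum_univ_two]
  have h11 : (unip * g) 1 1 = g 1 1 := by simp [coe_unip, Matrix.mul_apply, Fin.sum_univ_two]
  have hdet := sl_det_eq g
  have hX : X = X ^ (1 : ZMod 5).val := by rw [show (1 : ZMod 5).val = 1 from rfl, pow_one]
  unfold bruhat
  rw [h00, h01, h10, h11]
  generalize g 0 0 = a at *
  generalize g 0 1 = b at *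
  generalize g 1 0 = c at *
  generalize g 1 1 = d at *
  split_ifs with hc
  · subst hc
    have ha : a ≠ 0 := by rintro rfl; simp at hdet
    nth_rw 2 [hX]
    rw [add_zero, ← mul_assoc,
      show (1 : ZMod 5) = a ^ 2 * (a⁻¹ ^ 2) by field_simp,
      ← h.torus_mul_unipotent ha, mul_assoc, h.unipotent_mul]
    congr 3
    field_simp
    linear_combination hdet
  · nth_rw 3 [hX]
    simp only [← mul_assoc]
    rw [h.unipotent_mul]
    congr 5
    field_simp
    ring

lemma bruhat_weyl_mul (h : BruhatRelations X W D) (g : SL(2, ZMod 5)) :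
    bruhat X W D (weyl * g) = W * bruhat X W D g := by
  have h00 : (weyl * g) 0 0 = -g 1 0 := by simp [coe_weyl, Matrix.mul_apply, Fin.sum_univ_two]
  have h01 : (weyl * g) 0 1 = -g 1 1 := by simp [coe_weyl, Matrix.mul_apply, Fin.sum_univ_two]
  have h10 : (weyl * g) 1 0 = g 0 0 := by simp [coe_weyl, Matrix.mul_apply, Fin.sum_univ_two]
  have h11 : (weyl * g) 1 1 = g 0 1 := by simp [coe_weyl, Matrix.mul_apply, Fin.sum_univ_two]
  have hdet := sl_det_eq g
  unfold bruhat
  rw [h00, h01, h10, h11]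
  generalize g 0 0 = a at *
  generalize g 0 1 = b at *
  generalize g 1 0 = c at *
  generalize g 1 1 = d at *
  by_cases hc : c = 0
  · subst hc
    have ha : a ≠ 0 := by rintro rfl; simp at hdet
    simp [ha, mul_assoc, mul_comm]
  by_cases ha : a = 0
  · subst ha
    simp only [hc, if_true, if_false, zero_mul, ZMod.val_zero, pow_zero, one_mul]
    simp only [← mul_assoc]
    rw [h.weyl_mul_weyl, h.torus_mul (by decide) hc, neg_one_mul]
    congr 3
    field_simp
  · simp only [hc, ha, if_false]
    have hac : a * c⁻¹ ≠ 0 := mul_ne_zero ha (inv_ne_zero hc)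
    have hb := h.big_cell (a * c⁻¹) (-c * a⁻¹) (by field_simp)
    have e1 : -c * a⁻¹ = c ^ 2 * (-a⁻¹ * c⁻¹) := by field_simp
    have e2 : a * c⁻¹ * c = a := by field_simp
    have e3 : -a⁻¹ * c⁻¹ + d * c⁻¹ = b * a⁻¹ := by field_simp; linear_combination hdet
    rw [← mul_assoc, ← mul_assoc, ← mul_assoc, hb, mul_assoc _ (X ^ _) (D ^ log c)]
    nth_rw 3 [e1]
    rw [← h.torus_mul_unipotent hc, ← mul_assoc, mul_assoc _ (D ^ _) (D ^ _), h.torus_mul hac hc,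
      mul_assoc _ (X ^ _) (X ^ _), h.unipotent_mul, e2, e3]

lemma bruhat_one : bruhat X W D 1 = 1 := by
  simp [bruhat, log]

lemma transvection_mem_closure {i j : Fin 2} (hij : i ≠ j) (c : ZMod 5) :
    Matrix.SpecialLinearGroup.transvection hij c ∈ Subgroup.closure {unip, weyl} := by
  have hu : unip ∈ Subgroup.closure {unip, weyl} := Subgroup.subset_closure (by simp)
  have hw : weyl ∈ Subgroup.closure {unip, weyl} := Subgroup.subset_closure (by simp)
  have h : ∀ (i j : Fin 2) (hij : i ≠ j) (c : ZMod 5),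
      Matrix.SpecialLinearGroup.transvection hij c = unip ^ c.val ∨
      Matrix.SpecialLinearGroup.transvection hij c = weyl * unip ^ (-c).val * weyl⁻¹ := by
    decide
  obtain h | h := h i j hij c <;> rw [h]
  · exact pow_mem hu _
  · exact mul_mem (mul_mem hw (pow_mem hu _)) (inv_mem hw)

lemma closure_unip_weyl : Subgroup.closure {unip, weyl} = ⊤ := by
  rw [eq_top_iff]
  intro g _
  exact Matrix.SL2.transvection_induction _
    (fun i j hij c => transvection_mem_closure hij c) (fun A B hA hB => mul_mem hA hB) g

/-- The set of `g` with `bruhat (g * k) = bruhat g * bruhat k` for all `k` is a subgroup, and it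
contains the generators. -/
lemma bruhat_mul (h : BruhatRelations X W D) (g k : SL(2, ZMod 5)) :
    bruhat X W D (g * k) = bruhat X W D g * bruhat X W D k := by
  have hg : g ∈ Subgroup.closure {unip, weyl} := closure_unip_weyl ▸ Subgroup.mem_top g
  induction hg using Subgroup.closure_induction generalizing k with
  | mem x hx =>
    rcases hx with rfl | rfl
    · have := h.bruhat_unip_mul 1
      rw [mul_one, bruhat_one, mul_one] at this
      rw [h.bruhat_unip_mul, this]
    · have := h.bruhat_weyl_mul 1
      rw [mul_one, bruhat_one, mul_one] at this
      rw [h.bruhat_weyl_mul, this]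
  | one => rw [one_mul, bruhat_one, one_mul]
  | mul x y _ _ hx hy => rw [mul_assoc, hx, hy, hx, mul_assoc]
  | inv x _ hx =>
    have h1 : ∀ k, bruhat X W D (x⁻¹ * k) = (bruhat X W D x)⁻¹ * bruhat X W D k := fun k => by
      rw [eq_inv_mul_iff_mul_eq, ← hx, mul_inv_cancel_left]
    have h2 := h1 1
    rw [mul_one, bruhat_one, mul_one] at h2
    rw [h1, h2]

/-- Elements satisfying the Bruhat relations define a representation of `SL₂(F₅)`. -/
def hom (h : BruhatRelations X W D) : SL(2, ZMod 5) →* G where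
  toFun := bruhat X W D
  map_one' := bruhat_one
  map_mul' := h.bruhat_mul

lemma hom_unip (h : BruhatRelations X W D) : h.hom unip = X := by
  change bruhat X W D unip = X
  have := h.bruhat_unip_mul 1
  rwa [mul_one, bruhat_one, mul_one] at this

lemma hom_weyl (h : BruhatRelations X W D) : h.hom weyl = W := by
  change bruhat X W D weyl = W
  have := h.bruhat_weyl_mul 1
  rwa [mul_one, bruhat_one, mul_one] at this

lemma unipotent_eq_one_iff (h : BruhatRelations X W D) (hX : X ≠ 1) {n : ℕ} :
    X ^ n = 1 ↔ 5 ∣ n := by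
  rw [← orderOf_eq_prime h.pow_five hX, orderOf_dvd_iff_pow_eq_one]

/-- Outside the Borel subgroup, the Bruhat normal form never gives the identity. -/
lemma bruhat_ne_one_of_lower_ne_zero (h : BruhatRelations X W D) (hX : X ≠ 1)
    {g : SL(2, ZMod 5)} (hc : g 1 0 ≠ 0) : bruhat X W D g ≠ 1 := by
  intro h1
  rw [bruhat, if_neg hc] at h1
  generalize g 1 0 = c at *
  generalize (g 0 0 * c⁻¹).val = p at *
  generalize (g 1 1 * c⁻¹).val = q at *
  have hci : c⁻¹ ≠ 0 := inv_ne_zero hc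
  -- `W` is a power of `X` times an element of the torus, so it normalizes `⟨X⟩`
  have hW : W = (X ^ p)⁻¹ * (X ^ q)⁻¹ * D ^ log c⁻¹ := by
    have h2 : W * D ^ log c = (X ^ p)⁻¹ * (X ^ q)⁻¹ := by
      rw [eq_mul_inv_iff_mul_eq, eq_inv_iff_mul_eq_one]
      rw [mul_assoc, mul_assoc] at h1
      simpa only [mul_assoc] using mul_eq_one_comm.1 h1
    rw [← h2, mul_assoc, h.torus_mul hc hci, mul_inv_cancel₀ hc]
    simp [log]
  obtain ⟨e, he, hWX⟩ : ∃ e : ℕ, (e = 1 ∨ e = 4) ∧ W * X = X ^ e * W := by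
    have hsq : ∀ c : ZMod 5, c ≠ 0 → (c ^ 2 * 1).val = 1 ∨ (c ^ 2 * 1).val = 4 := by decide
    refine ⟨_, hsq _ hci, ?_⟩
    have h3 := h.torus_mul_unipotent hci 1
    rw [show (1 : ZMod 5).val = 1 from rfl, pow_one] at h3
    generalize (c⁻¹ ^ 2 * 1).val = m at *
    have hcomm : Commute (X ^ m) ((X ^ p)⁻¹ * (X ^ q)⁻¹) :=
      (((Commute.refl X).pow_pow m p).inv_right).mul_right ((Commute.refl X).pow_pow m q).inv_right
    rw [hW, mul_assoc, h3, ← mul_assoc, ← hcomm.eq, mul_assoc]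
  have hbig : W * X * W = X ^ 4 * W * X ^ 4 := by
    simpa [log, show (1 : ZMod 5).val = 1 from rfl, show (4 : ZMod 5).val = 4 from rfl]
      using h.big_cell 1 4 (by decide)
  have hW4 : W * X ^ 4 = X ^ (4 * e) * W := by
    rw [mul_comm, pow_mul]
    exact SemiconjBy.pow_right (show SemiconjBy W X (X ^ e) from hWX) 4
  have hW' : W = X ^ (4 + 3 * e) := by
    rw [hWX, mul_assoc (X ^ 4), hW4, ← mul_assoc, mul_left_inj, ← pow_add] at hbig
    rw [← mul_right_inj (X ^ e), hbig, ← pow_add]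
    congr 1
    ring
  have he1 : e = 1 := by
    refine he.resolve_right fun h4 => hX ?_
    rw [hW', h4, ← pow_succ, ← pow_add] at hWX
    have h3 : X ^ 3 = 1 := by
      rw [← mul_right_inj (X ^ 17), ← pow_add, mul_one]
      exact hWX.symm
    rw [h.unipotent_eq_one_iff hX] at h3
    omega
  subst he1
  have h8 : X ^ 28 = 1 := by
    rw [← h.pow_four, pow_mul D 2 2 , ← h.sq_eq, hW', ← pow_mul, ← pow_mul]
  rw [h.unipotent_eq_one_iff hX] at h8
  omega

/-- The kernel of the Bruhat map is contained in `{±1}`, because `D ^ log a` conjugates `X` to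
`X ^ (a ^ 2)`. -/
lemma eq_one_or_of_bruhat_eq_one (h : BruhatRelations X W D) (hX : X ≠ 1)
    {g : SL(2, ZMod 5)} (h1 : bruhat X W D g = 1) : g = 1 ∨ g = -1 ∧ D ^ 2 = 1 := by
  have hc : g 1 0 = 0 := by
    by_contra hc
    exact h.bruhat_ne_one_of_lower_ne_zero hX hc h1
  rw [bruhat, if_pos hc] at h1
  have hdet := sl_det_eq g
  rw [hc, mul_zero, sub_zero] at hdet
  have ha : g 0 0 ≠ 0 := left_ne_zero_of_mul_eq_one hdet
  have hg : ∀ u : ZMod 5, g 0 0 = u → g 0 1 = 0 → g 1 1 = u →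
      (g : Matrix (Fin 2) (Fin 2) (ZMod 5)) = !![u, 0; 0, u] := by
    intro u h1 h2 h3
    rw [Matrix.eta_fin_two (g : Matrix (Fin 2) (Fin 2) (ZMod 5)), h1, h2, h3, hc]
  have hD : D ^ log (g 0 0) = (X ^ ((g 0 0)⁻¹ * g 0 1).val)⁻¹ := eq_inv_of_mul_eq_one_left h1
  have hone : (1 : ZMod 5).val = 1 := rfl
  have hsq : ∀ a : ZMod 5, a ≠ 0 → a = 1 ∨ a = -1 ∨ (a ^ 2 * 1).val = 4 := by decide
  have ha1 : g 0 0 = 1 ∨ g 0 0 = -1 := by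
    by_contra hne
    have h4 := (hsq _ ha).resolve_left fun h => hne (Or.inl h)
    replace h4 := h4.resolve_left fun h => hne (Or.inr h)
    -- otherwise a power of `X` would conjugate `X` to `X ^ 4`
    have h3 := h.torus_mul_unipotent ha 1
    rw [h4, hone, pow_one, hD, ← ((Commute.refl X).pow_right _).inv_right.eq, mul_left_inj] at h3
    have h5 : X ^ 3 = 1 := by
      rw [← mul_right_inj X, ← pow_succ', mul_one]
      exact h3.symm
    rw [h.unipotent_eq_one_iff hX] at h5
    omega
  have hm : X ^ (((g 0 0)⁻¹ * g 0 1).val * 2) = 1 := by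
    have h2 : D ^ (log (g 0 0) * 2) = 1 := by
      rcases ha1 with h1 | h1 <;> rw [h1]
      · exact pow_zero D
      · exact h.pow_four
    rw [pow_mul, hD, inv_pow, inv_eq_one, ← pow_mul] at h2
    exact h2
  have hb : (g 0 0)⁻¹ * g 0 1 = 0 := by
    rw [h.unipotent_eq_one_iff hX] at hm
    rw [← ZMod.val_eq_zero]
    have := ZMod.val_lt ((g 0 0)⁻¹ * g 0 1)
    omega
  rw [hb, ZMod.val_zero, pow_zero, mul_one] at h1
  have hb' : g 0 1 = 0 := (mul_eq_zero.1 hb).resolve_left (inv_ne_zero ha)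
  rcases ha1 with ha1 | ha1
  · left
    apply Subtype.ext
    rw [hg 1 ha1 hb' (by rw [ha1, one_mul] at hdet; exact hdet), ← Matrix.one_fin_two]
    rfl
  · right
    constructor
    · apply Subtype.ext
      rw [hg (-1) ha1 hb' (by rw [ha1] at hdet; linear_combination -hdet),
        Matrix.SpecialLinearGroup.coe_neg, Matrix.SpecialLinearGroup.coe_one, Matrix.one_fin_two]
      simp
    · rw [ha1] at h1
      exact h1

/-- The representation is faithful as soon as `X ≠ 1` and `D² = W² ≠ 1`. -/
lemma hom_injective (h : BruhatRelations X W D) (hX : X ≠ 1) (hD : D ^ 2 ≠ 1) :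
    Function.Injective h.hom := by
  rw [injective_iff_map_eq_one]
  intro g hg
  exact (h.eq_one_or_of_bruhat_eq_one hX hg).resolve_right fun h2 => hD h2.2

lemma bruhat_neg_one : bruhat X W D (-1) = D ^ 2 := by
  simp [bruhat, log]

/-- If `X ≠ 1` and `D² = W² = 1`, the representation factors through a faithful representation of
`PSL₂(F₅)`. -/
lemma hom_eq_one_iff (h : BruhatRelations X W D) (hX : X ≠ 1) (hD : D ^ 2 = 1)
    (g : SL(2, ZMod 5)) : h.hom g = 1 ↔ g = 1 ∨ g = -1 := by
  constructor
  · exact fun hg => (h.eq_one_or_of_bruhat_eq_one hX hg).imp_right And.left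
  · rintro (rfl | rfl)
    · exact map_one _
    · exact (bruhat_neg_one (X := X) (W := W)).trans hD

end BruhatRelations

/-! ### The relations in `SL₂(F_p)` and in the alternating group -/

section

variable {F : Type*} [Field F]

lemma sl_sq (g : SL(2, F)) : (g : Matrix (Fin 2) (Fin 2) F) ^ 2 =
    (g 0 0 + g 1 1) • (g : Matrix (Fin 2) (Fin 2) F) - 1 := by
  have h := sl_det_eq g
  rw [sl_coe_eq g, Matrix.one_fin_two]
  ext i j
  fin_cases i <;> fin_cases j <;> simp [pow_two] <;> grind

/-- The conic parametrizing the elements `W` of order four for which `X * W` has trace one, where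
`X` is a given element of trace `t`, has a point over every finite field of odd characteristic. -/
lemma exists_conic_point [Fintype F] (h2 : (2 : F) ≠ 0) {t : F} (ht : t ^ 2 - 4 ≠ 0) :
    ∃ u w : F, u ^ 2 + t * u * w + w ^ 2 + w + 1 = 0 := by
  have h2' : ringChar F ≠ 2 := fun h => h2 (by
    have := ringChar.Nat.cast_ringChar (R := F)
    rw [h] at this
    exact_mod_cast this)
  have hodd := FiniteField.odd_card_of_char_ne_two h2'
  have hd : (1 - t ^ 2 / 4 : F) ≠ 0 := by
    intro h
    apply ht
    have h4 : (4 : F) ≠ 0 := by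
      rw [show (4 : F) = 2 * 2 by norm_num]
      exact mul_ne_zero h2 h2
    field_simp at h
    linear_combination -h
  obtain ⟨a, b, hab⟩ := FiniteField.exists_root_sum_quadratic (R := F)
    (f := Polynomial.X ^ 2)
    (g := Polynomial.C (1 - t ^ 2 / 4) * Polynomial.X ^ 2 + Polynomial.C 1 * Polynomial.X +
      Polynomial.C 1) (Polynomial.degree_X_pow 2) (Polynomial.degree_quadratic hd)
      hodd
  refine ⟨a - t * b / 2, b, ?_⟩
  simp only [Polynomial.eval_add, Polynomial.eval_mul, Polynomial.eval_C, Polynomial.eval_pow,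
    Polynomial.eval_X] at hab
  have h4 : (4 : F) = 2 * 2 := by norm_num
  rw [h4] at hab
  field_simp at hab ⊢
  linear_combination hab

/-- Matrices of determinant one satisfying the Bruhat relations of `SL₂(F₅)`: here `X` has order
five, `W` has order four and `X * W` has order six, while `D` is the multiple `t (X W - W X)` of
the commutator, which anticommutes with `W` and inverts `X`. -/
lemma bruhatRelations_of_conic {t u v w : F} (ht : t ^ 2 + t - 1 = 0)
    (hv : v = 1 + w + t * u) (hc : u ^ 2 + t * u * w + w ^ 2 + w + 1 = 0) (X W D : SL(2, F))
    (hX : (X : Matrix (Fin 2) (Fin 2) F) = !![0, -1; 1, t])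
    (hW : (W : Matrix (Fin 2) (Fin 2) F) = !![u, v; w, -u])
    (hD : (D : Matrix (Fin 2) (Fin 2) F) =
      !![-t * (w + v), t * (2 * u - t * v); t * (2 * u + t * w), t * (w + v)]) :
    BruhatRelations X W D ∧ D ^ 2 = -1 := by
  have hX2 : (X : Matrix (Fin 2) (Fin 2) F) ^ 2 = !![-1, -t; t, -t] := by
    rw [hX, pow_two, Matrix.mul_fin_two]
    ext i j; fin_cases i <;> fin_cases j <;> simp <;> grind
  have hX3 : (X : Matrix (Fin 2) (Fin 2) F) ^ 3 = !![-t, t; -t, -1] := by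
    rw [pow_succ, hX2, hX, Matrix.mul_fin_two]
    ext i j; fin_cases i <;> fin_cases j <;> simp <;> grind
  have hX4 : (X : Matrix (Fin 2) (Fin 2) F) ^ 4 = !![t, 1; -1, 0] := by
    rw [pow_succ, hX3, hX, Matrix.mul_fin_two]
    ext i j; fin_cases i <;> fin_cases j <;> simp <;> grind
  have hW2 : W ^ 2 = -1 := by
    apply sl_coe_injective
    rw [Matrix.SpecialLinearGroup.coe_pow,
        Matrix.SpecialLinearGroup.coe_neg,
      Matrix.SpecialLinearGroup.coe_one, pow_two, hW, Matrix.mul_fin_two, Matrix.one_fin_two]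
    ext i j; fin_cases i <;> fin_cases j <;> simp <;> grind
  have hD2 : D ^ 2 = -1 := by
    apply sl_coe_injective
    rw [Matrix.SpecialLinearGroup.coe_pow,
        Matrix.SpecialLinearGroup.coe_neg,
      Matrix.SpecialLinearGroup.coe_one, pow_two, hD, Matrix.mul_fin_two, Matrix.one_fin_two]
    ext i j; fin_cases i <;> fin_cases j <;> simp <;> grind
  have hD3 : D ^ 3 = -D := by rw [pow_succ, hD2, neg_one_mul]
  refine ⟨⟨?_, ?_, hW2.trans hD2.symm, ?_, ?_⟩, hD2⟩
  · apply sl_coe_injective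
    rw [Matrix.SpecialLinearGroup.coe_pow, Matrix.SpecialLinearGroup.coe_one,
      pow_succ, hX4, hX, Matrix.mul_fin_two, Matrix.one_fin_two]
    ext i j; fin_cases i <;> fin_cases j <;> simp
  · rw [pow_mul D 2 2, hD2, neg_one_sq]
  · apply sl_coe_injective
    rw [Matrix.SpecialLinearGroup.coe_mul, Matrix.SpecialLinearGroup.coe_mul,
      Matrix.SpecialLinearGroup.coe_pow, hX4, hX, hD, Matrix.mul_fin_two, Matrix.mul_fin_two]
    ext i j; fin_cases i <;> fin_cases j <;> simp <;> grind
  · intro m n hmn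
    have hcases : ∀ m n : ZMod 5, m * n = -1 → m = 1 ∧ n = 4 ∨ m = 2 ∧ n = 2 ∨
        m = 3 ∧ n = 3 ∨ m = 4 ∧ n = 1 := by decide
    have h1 : (1 : ZMod 5).val = 1 := rfl
    have h2 : (2 : ZMod 5).val = 2 := rfl
    have h3 : (3 : ZMod 5).val = 3 := rfl
    have h4 : (4 : ZMod 5).val = 4 := rfl
    have l1 : BruhatRelations.log 1 = 0 := rfl
    have l2 : BruhatRelations.log 2 = 1 := rfl
    have l3 : BruhatRelations.log 3 = 3 := rfl
    have l4 : BruhatRelations.log 4 = 2 := rfl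
    apply sl_coe_injective
    obtain ⟨rfl, rfl⟩ | ⟨rfl, rfl⟩ | ⟨rfl, rfl⟩ | ⟨rfl, rfl⟩ := hcases m n hmn
    · rw [l1, h1, h4, pow_one, pow_zero, mul_one]
      simp only [Matrix.SpecialLinearGroup.coe_mul, Matrix.SpecialLinearGroup.coe_pow]
      rw [hX4, hX, hW]
      simp only [Matrix.mul_fin_two]
      ext i j; fin_cases i <;> fin_cases j <;> simp <;> grind
    · rw [l2, h2, pow_one]
      simp only [Matrix.SpecialLinearGroup.coe_mul, Matrix.SpecialLinearGroup.coe_pow]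
      rw [hX2, hW, hD]
      simp only [Matrix.mul_fin_two]
      ext i j; fin_cases i <;> fin_cases j <;> simp <;> grind
    · rw [l3, h3, hD3]
      simp only [Matrix.SpecialLinearGroup.coe_mul, Matrix.SpecialLinearGroup.coe_pow,
        Matrix.SpecialLinearGroup.coe_neg]
      rw [hX3, hW, hD]
      simp only [Matrix.mul_fin_two, mul_neg, neg_mul]
      ext i j; fin_cases i <;> fin_cases j <;> simp <;> grind
    · rw [l4, h1, h4, hD2, pow_one]
      simp only [Matrix.SpecialLinearGroup.coe_mul, Matrix.SpecialLinearGroup.coe_pow,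
        Matrix.SpecialLinearGroup.coe_neg,
        mul_neg, mul_one, neg_mul]
      rw [hX4, hX, hW]
      simp only [Matrix.mul_fin_two]
      ext i j; fin_cases i <;> fin_cases j <;> simp <;> grind
end

/-- Permutations realizing the Bruhat relations in the alternating group. -/
lemma bruhatRelations_perm : BruhatRelations (c[0, 1, 2, 3, 4] : Equiv.Perm (Fin 5))
    (c[1, 2] * c[3, 4]) (c[1, 4] * c[2, 3]) := by
  constructor <;> decide +kernel

/-! ### Orders, centers and embeddings -/

/-- The determinant `GL₂ → F_pˣ` is onto with kernel `SL₂`, which gives the order of `SL₂(F_p)`. -/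
lemma card_SL2 (p : ℕ) [Fact p.Prime] : Nat.card SL(2, ZMod p) = p * (p ^ 2 - 1) := by
  have hp : 2 ≤ p := (Fact.out : p.Prime).two_le
  have hker : (Matrix.GeneralLinearGroup.det (n := Fin 2) (R := ZMod p)).ker =
      (Matrix.SpecialLinearGroup.toGL (n := Fin 2) (R := ZMod p)).range := by
    ext g
    constructor
    · intro hg
      refine ⟨⟨g.1, ?_⟩, ?_⟩
      · rw [MonoidHom.mem_ker] at hg
        have := congrArg Units.val hg
        exact this
      · ext; rfl
    · rintro ⟨s, rfl⟩
      rw [MonoidHom.mem_ker]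
      ext
      exact s.2
  have h1 := Subgroup.card_mul_index (Matrix.GeneralLinearGroup.det (n := Fin 2) (R := ZMod p)).ker
  rw [Subgroup.index_ker, MonoidHom.range_eq_top.2 Matrix.GeneralLinearGroup.det_surjective,
    Subgroup.card_top, hker, Matrix.card_GL_field, Fin.prod_univ_two, ZMod.card,
    Nat.card_eq_fintype_card (α := (ZMod p)ˣ), ZMod.card_units,
    ← Nat.card_congr (MonoidHom.ofInjective Matrix.SpecialLinearGroup.toGL_injective).toEquiv] at h1
  apply Nat.eq_of_mul_eq_mul_right (show 0 < p - 1 by omega)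
  rw [h1]
  obtain ⟨q, rfl⟩ := Nat.exists_eq_add_of_le' (show 1 ≤ p by omega)
  simp only [Fin.val_zero, Fin.val_one, pow_zero, pow_one, Nat.add_sub_cancel]
  have h3 : (q + 1) ^ 2 - (q + 1) = (q + 1) * q := by
    rw [pow_two, ← Nat.mul_sub_one]; rfl
  rw [h3]
  ring

lemma mem_center_SL2_iff {F : Type*} [Field F] {g : SL(2, F)} :
    g ∈ Subgroup.center SL(2, F) ↔ g = 1 ∨ g = -1 := by
  rw [Matrix.SpecialLinearGroup.mem_center_iff]
  constructor
  · rintro ⟨r, hr, hg⟩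
    rw [Fintype.card_fin] at hr
    rw [pow_two] at hr
    rcases mul_self_eq_one_iff.1 hr with rfl | rfl
    · left; apply sl_coe_injective; rw [← hg]; simp
    · right; apply sl_coe_injective; rw [← hg]; simp [← Matrix.diagonal_one, Matrix.diagonal_neg]
  · rintro (rfl | rfl)
    · exact ⟨1, by simp, by simp⟩
    · exact ⟨-1, by simp, by simp [← Matrix.diagonal_one, Matrix.diagonal_neg]⟩

lemma one_ne_neg_one_SL2 {F : Type*} [Field F] (h2 : (2 : F) ≠ 0) : (1 : SL(2, F)) ≠ -1 := by
  intro h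
  have := congrArg (fun g : SL(2, F) => g 0 0) h
  simp at this
  apply h2
  linear_combination this

lemma card_center_SL2 (p : ℕ) [Fact p.Prime] (hp : p ≠ 2) :
    Nat.card (Subgroup.center SL(2, ZMod p)) = 2 := by
  have h2 : (2 : ZMod p) ≠ 0 := by
    have := (Fact.out : p.Prime).two_le
    exact_mod_cast natCast_ne_zero_of_lt (p := p) (n := 2) (by omega) (by omega)
  have h : (Subgroup.center SL(2, ZMod p) : Set SL(2, ZMod p)) = {1, -1} := by
    ext g
    exact mem_center_SL2_iff
  rw [← SetLike.coe_sort_coe, h, Nat.card_coe_set_eq, Set.ncard_pair (one_ne_neg_one_SL2 h2)]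

lemma eq_of_card_SL2_eq {p q : ℕ} (hp : 2 ≤ p) (h : p * (p ^ 2 - 1) = q * (q ^ 2 - 1)) :
    p = q := by
  have key : ∀ a b : ℕ, 2 ≤ a → a < b → a * (a ^ 2 - 1) < b * (b ^ 2 - 1) := fun a b ha hab =>
    Nat.mul_lt_mul_of_lt_of_le hab (Nat.sub_le_sub_right (Nat.pow_le_pow_left hab.le 2) 1)
      (Nat.sub_pos_of_lt (Nat.one_lt_pow two_ne_zero (by omega)))
  rcases lt_trichotomy p q with h1 | h1 | h1
  · exact absurd h (key p q hp h1).ne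
  · exact h1
  · by_cases hq : 2 ≤ q
    · exact absurd h (key q p hq h1).ne'
    · interval_cases q
      · simp at h; have := Nat.one_lt_pow (a := p) two_ne_zero (by omega); omega
      · simp at h; have := Nat.one_lt_pow (a := p) two_ne_zero (by omega); omega

lemma isEmpty_SL2_mulEquiv {p q : ℕ} [Fact p.Prime] [Fact q.Prime] (hpq : p ≠ q) :
    IsEmpty (SL(2, ZMod p) ≃* SL(2, ZMod q)) := by
  refine ⟨fun e => hpq (eq_of_card_SL2_eq (Fact.out : p.Prime).two_le ?_)⟩
  rw [← card_SL2, ← card_SL2]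
  exact Nat.card_congr e.toEquiv

lemma isEmpty_PSL2_mulEquiv {p q : ℕ} [Fact p.Prime] [Fact q.Prime] (hp : p ≠ 2) (hq : q ≠ 2)
    (hpq : p ≠ q) : IsEmpty (PSL(2, ZMod p) ≃* PSL(2, ZMod q)) := by
  refine ⟨fun e => hpq (eq_of_card_SL2_eq (Fact.out : p.Prime).two_le ?_)⟩
  rw [← card_SL2, ← card_SL2, Subgroup.card_eq_card_quotient_mul_card_subgroup (Subgroup.center _),
    Subgroup.card_eq_card_quotient_mul_card_subgroup (Subgroup.center SL(2, ZMod q)),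
    card_center_SL2 p hp, card_center_SL2 q hq, Nat.card_congr e.toEquiv]

lemma infinite_scottPrimes : scottPrimes.Infinite := by
  refine (Nat.infinite_setOfPred_prime_and_modEq (q := 120) (a := 29) (by norm_num)
    (by norm_num)).mono ?_
  rintro p ⟨hp, hmod⟩
  refine ⟨hp, Or.inl ?_⟩
  exact_mod_cast (Int.natCast_modEq_iff.2 hmod)

/-- The isomorphism `PSL₂(F₅) ≃ A₅`, as a surjection from `SL₂(F₅)` with kernel `{±1}`. -/
lemma exists_hom_alternatingGroup : ∃ f : SL(2, ZMod 5) →* alternatingGroup (Fin 5),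
    Function.Surjective f ∧ ∀ g, f g = 1 ↔ g = 1 ∨ g = -1 := by
  have h := bruhatRelations_perm
  have hmem : ∀ g, h.hom g ∈ alternatingGroup (Fin 5) := by
    intro g
    have hg : g ∈ Subgroup.closure {BruhatRelations.unip, BruhatRelations.weyl} :=
      BruhatRelations.closure_unip_weyl ▸ Subgroup.mem_top g
    have hle : Subgroup.closure {BruhatRelations.unip, BruhatRelations.weyl} ≤
        (alternatingGroup (Fin 5)).comap h.hom := by
      rw [Subgroup.closure_le]
      rintro x (rfl | rfl)
      · rw [SetLike.mem_coe, Subgroup.mem_comap, h.hom_unip, Equiv.Perm.mem_alternatingGroup]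
        decide
      · rw [SetLike.mem_coe, Subgroup.mem_comap, h.hom_weyl, Equiv.Perm.mem_alternatingGroup]
        decide
    exact hle hg
  have hker : ∀ g, h.hom.codRestrict _ hmem g = 1 ↔ g = 1 ∨ g = -1 := by
    intro g
    rw [← h.hom_eq_one_iff (by decide) (by decide), Subtype.ext_iff]
    rfl
  refine ⟨h.hom.codRestrict _ hmem, ?_, hker⟩
  -- both groups have sixty elements
  have h1 := Subgroup.card_mul_index (h.hom.codRestrict _ hmem).ker
  have hk : (h.hom.codRestrict _ hmem).ker = Subgroup.center SL(2, ZMod 5) := by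
    ext g
    rw [MonoidHom.mem_ker, hker, mem_center_SL2_iff]
  rw [Subgroup.index_ker, hk, card_center_SL2 5 (by norm_num), card_SL2] at h1
  have h2 := two_mul_nat_card_alternatingGroup (α := Fin 5)
  rw [Nat.card_perm, Nat.card_eq_fintype_card (α := Fin 5), Fintype.card_fin] at h2
  have h3 : Nat.factorial 5 = 120 := rfl
  rw [← MonoidHom.range_eq_top]
  apply Subgroup.eq_top_of_card_eq
  omega

/-- For `p ≡ ±29 mod 120`, the group `SL₂(F_p)` contains a copy of `SL₂(F₅)`. -/
lemma exists_hom_SL2_five {p : ℕ} [Fact p.Prime] (hp : p % 120 = 29 ∨ p % 120 = 91) :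
    ∃ ρ : SL(2, ZMod 5) →* SL(2, ZMod p), Function.Injective ρ := by
  have h2 : (2 : ZMod p) ≠ 0 := by
    exact_mod_cast natCast_ne_zero_of_lt (p := p) (n := 2) (by omega) (by omega)
  have h5 : (5 : ZMod p) ≠ 0 := by
    exact_mod_cast natCast_ne_zero_of_lt (p := p) (n := 5) (by omega) (by omega)
  obtain ⟨t, ht⟩ := exists_golden_root hp
  obtain ⟨u, w, hc⟩ := exists_conic_point h2 (t := t) (fun h => h5 (by grind))
  obtain ⟨h, hD⟩ := bruhatRelations_of_conic ht rfl hc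
    ⟨!![0, -1; 1, t], by rw [Matrix.det_fin_two_of]; ring⟩
    ⟨!![u, 1 + w + t * u; w, -u], by rw [Matrix.det_fin_two_of]; linear_combination -hc⟩
    ⟨!![-t * (w + (1 + w + t * u)), t * (2 * u - t * (1 + w + t * u)); t * (2 * u + t * w),
      t * (w + (1 + w + t * u))], by rw [Matrix.det_fin_two_of]; grind⟩ rfl rfl rfl
  refine ⟨h.hom, h.hom_injective ?_ ?_⟩
  · intro hX
    have := congrArg (fun g : SL(2, ZMod p) => g 1 0) hX
    simp at this
  · rw [hD]
    exact (one_ne_neg_one_SL2 h2).symm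

/-! ### Conjugation by `GL₂` and traces -/

section
variable {F : Type*} [Field F]

/-- Conjugation by an invertible matrix, as an automorphism of `SL₂`. -/
def conjSL : GL (Fin 2) F →* MulAut SL(2, F) where
  toFun n :=
    { toFun := fun g => ⟨n.1 * g.1 * n⁻¹.1, by
        rw [Matrix.det_mul, Matrix.det_mul, g.2, mul_one, ← Matrix.det_mul, ← Units.val_mul,
          mul_inv_cancel, Units.val_one, Matrix.det_one]⟩
      invFun := fun g => ⟨n⁻¹.1 * g.1 * n.1, by
        rw [Matrix.det_mul, Matrix.det_mul, g.2, mul_one, ← Matrix.det_mul, ← Units.val_mul,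
          inv_mul_cancel, Units.val_one, Matrix.det_one]⟩
      left_inv := fun g => Subtype.ext (by
        change n⁻¹.1 * (n.1 * g.1 * n⁻¹.1) * n.1 = g.1
        simp only [Matrix.mul_assoc, ← Units.val_mul, inv_mul_cancel, Units.val_one, Matrix.mul_one]
        rw [← Matrix.mul_assoc, ← Units.val_mul, inv_mul_cancel, Units.val_one, Matrix.one_mul])
      right_inv := fun g => Subtype.ext (by
        change n.1 * (n⁻¹.1 * g.1 * n.1) * n⁻¹.1 = g.1
        simp only [Matrix.mul_assoc, ← Units.val_mul, mul_inv_cancel, Units.val_one, Matrix.mul_one]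
        rw [← Matrix.mul_assoc, ← Units.val_mul, mul_inv_cancel, Units.val_one, Matrix.one_mul])
      map_mul' := fun g k => Subtype.ext (by
        change n.1 * (g.1 * k.1) * n⁻¹.1 = n.1 * g.1 * n⁻¹.1 * (n.1 * k.1 * n⁻¹.1)
        have h : n⁻¹.1 * (n.1 * (k.1 * n⁻¹.1)) = k.1 * n⁻¹.1 := by
          rw [← Matrix.mul_assoc, ← Units.val_mul, inv_mul_cancel, Units.val_one, Matrix.one_mul]
        simp only [Matrix.mul_assoc, h]) }
  map_one' := by
    ext1 g
    apply Subtype.ext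
    change (1 : GL (Fin 2) F).1 * g.1 * (1 : GL (Fin 2) F)⁻¹.1 = g.1
    rw [inv_one, Units.val_one, Matrix.one_mul, Matrix.mul_one]
  map_mul' m n := by
    ext1 g
    apply Subtype.ext
    change (m * n).1 * g.1 * (m * n)⁻¹.1 = m.1 * (n.1 * g.1 * n⁻¹.1) * m⁻¹.1
    rw [_root_.mul_inv_rev, Units.val_mul, Units.val_mul]
    simp only [Matrix.mul_assoc]

lemma toGL_conjSL (n : GL (Fin 2) F) (g : SL(2, F)) :
    Matrix.SpecialLinearGroup.toGL (conjSL n g) =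
      n * Matrix.SpecialLinearGroup.toGL g * n⁻¹ :=
  Units.ext rfl

lemma conjSL_eq_iff {n : GL (Fin 2) F} {g k : SL(2, F)} :
    conjSL n g = k ↔ (n : Matrix (Fin 2) (Fin 2) F) * (g : Matrix (Fin 2) (Fin 2) F) =
      (k : Matrix (Fin 2) (Fin 2) F) * (n : Matrix (Fin 2) (Fin 2) F) := by
  rw [← Matrix.SpecialLinearGroup.toGL_injective.eq_iff, toGL_conjSL, mul_inv_eq_iff_eq_mul,
    Units.ext_iff]
  rfl

lemma conjSL_toGL (s g : SL(2, F)) :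
    conjSL (Matrix.SpecialLinearGroup.toGL s) g = s * g * s⁻¹ := by
  rw [conjSL_eq_iff]
  change ((s * g : SL(2, F)) : Matrix (Fin 2) (Fin 2) F) =
    ((s * g * s⁻¹ * s : SL(2, F)) : Matrix (Fin 2) (Fin 2) F)
  rw [inv_mul_cancel_right]

lemma conjSL_neg_one (n : GL (Fin 2) F) : conjSL n (-1) = -1 := by
  rw [conjSL_eq_iff]
  simp

lemma sl_sq_eq (g : SL(2, F)) : (g : Matrix (Fin 2) (Fin 2) F) ^ 2 =
    (g : Matrix (Fin 2) (Fin 2) F).trace • (g : Matrix (Fin 2) (Fin 2) F) - 1 := by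
  rw [Matrix.trace_fin_two]
  exact sl_sq g

lemma smul_one_sl {g : SL(2, F)} {c : F} (h : (g : Matrix (Fin 2) (Fin 2) F) = c • 1) :
    g = 1 ∨ g = -1 := by
  have hd := g.2
  rw [h, Matrix.det_smul, Matrix.det_one, Fintype.card_fin, mul_one, pow_two] at hd
  rcases mul_self_eq_one_iff.1 hd with rfl | rfl
  · left; apply sl_coe_injective; rw [h]; simp
  · right; apply sl_coe_injective; rw [h]; simp

/-- The commutant of a non-scalar two-by-two matrix consists of its linear polynomials. -/
lemma exists_eq_add_smul_of_commute {g : SL(2, F)} (h1 : g ≠ 1) (h2 : g ≠ -1)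
    {B : Matrix (Fin 2) (Fin 2) F} (h : (g : Matrix (Fin 2) (Fin 2) F) * B = B * g) :
    ∃ α β : F, B = α • 1 + β • (g : Matrix (Fin 2) (Fin 2) F) := by
  have hns : ¬ (g 0 1 = 0 ∧ g 1 0 = 0 ∧ g 0 0 = g 1 1) := by
    rintro ⟨h01, h10, h00⟩
    have hg : (g : Matrix (Fin 2) (Fin 2) F) = (g 0 0) • (1 : Matrix (Fin 2) (Fin 2) F) := by
      rw [sl_coe_eq g, h01, h10, ← h00]
      ext i j
      fin_cases i <;> fin_cases j <;> simp
    exact (smul_one_sl hg).elim h1 h2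
  rw [sl_coe_eq g] at h ⊢
  rw [Matrix.eta_fin_two B, Matrix.mul_fin_two, Matrix.mul_fin_two] at h
  have e00 := congrFun (congrFun h 0) 0
  have e01 := congrFun (congrFun h 0) 1
  have e10 := congrFun (congrFun h 1) 0
  simp at e00 e01 e10
  generalize g 0 0 = a at *
  generalize g 0 1 = b at *
  generalize g 1 0 = c at *
  generalize g 1 1 = d at *
  have key : ∀ β, B 0 1 = β * b → B 1 0 = β * c → B 1 1 - B 0 0 = β * (d - a) →
      ∃ α β : F, B = α • 1 + β • !![a, b; c, d] := by
    intro β k1 k2 k3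
    refine ⟨B 0 0 - β * a, β, ?_⟩
    ext i j
    fin_cases i <;> fin_cases j <;> simp [k1, k2]
    linear_combination k3
  by_cases hb : b = 0
  · by_cases hc : c = 0
    · have hda : d - a ≠ 0 := fun h => hns ⟨hb, hc, by linear_combination -h⟩
      subst hb hc
      refine key ((B 1 1 - B 0 0) / (d - a)) ?_ ?_ ?_ <;> field_simp
      · linear_combination -e01
      · linear_combination e10
    · refine key (B 1 0 / c) ?_ ?_ ?_ <;> field_simp
      · linear_combination -e00
      · linear_combination -e10
  · refine key (B 0 1 / b) ?_ ?_ ?_ <;> field_simp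
    · linear_combination e00
    · linear_combination e01

/-- Commuting elements of equal trace are equal or inverse to each other, unless that trace is
`±2`. -/
lemma eq_or_eq_inv_of_commute (h2 : (2 : F) ≠ 0) {x y : SL(2, F)} (h : x * y = y * x)
    (ht : (y : Matrix (Fin 2) (Fin 2) F).trace = (x : Matrix (Fin 2) (Fin 2) F).trace)
    (h4 : (x : Matrix (Fin 2) (Fin 2) F).trace ^ 2 ≠ 4) : y = x ∨ y = x⁻¹ := by
  have hx1 : x ≠ 1 := by rintro rfl; apply h4; simp; norm_num
  have hx2 : x ≠ -1 := by rintro rfl; apply h4; simp; norm_num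
  obtain ⟨α, β, hy⟩ := exists_eq_add_smul_of_commute hx1 hx2
    (congrArg (fun g : SL(2, F) => (g : Matrix (Fin 2) (Fin 2) F)) h)
  have hdx := sl_det_eq x
  have hdy := y.2
  rw [hy, sl_coe_eq x] at ht hdy
  rw [sl_coe_eq x] at h4
  simp [Matrix.det_fin_two, Matrix.trace_fin_two] at ht hdy h4
  have hα : 2 * α = (x 0 0 + x 1 1) * (1 - β) := by linear_combination ht
  have hβ : (β - 1) * (β + 1) = 0 := by
    apply mul_right_cancel₀ (sub_ne_zero.2 h4)
    have h5 : 4 * (α ^ 2 + α * β * (x 0 0 + x 1 1) + β ^ 2) = 4 := by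
      linear_combination 4 * hdy - 4 * β ^ 2 * hdx
    linear_combination -h5 + (2 * α + (x 0 0 + x 1 1) * (1 + β)) * hα
  rcases mul_eq_zero.1 hβ with hβ | hβ
  · left
    apply sl_coe_injective
    obtain rfl : β = 1 := by linear_combination hβ
    have hα0 : α = 0 := mul_left_cancel₀ h2 (by linear_combination hα)
    rw [hy, hα0, zero_smul, one_smul, zero_add]
  · right
    apply sl_coe_injective
    obtain rfl : β = -1 := by linear_combination hβ
    have hα0 : α = x 0 0 + x 1 1 := mul_left_cancel₀ h2 (by linear_combination hα)
    rw [hy, hα0, Matrix.SpecialLinearGroup.coe_inv, Matrix.adjugate_fin_two, sl_coe_eq x]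
    ext i j
    fin_cases i <;> fin_cases j <;> simp

lemma trace_sl_conj (k x : SL(2, F)) : ((k * x * k⁻¹ : SL(2, F)) : Matrix (Fin 2) (Fin 2) F).trace =
    (x : Matrix (Fin 2) (Fin 2) F).trace := by
  rw [Matrix.SpecialLinearGroup.coe_mul, Matrix.trace_mul_comm,
    ← Matrix.SpecialLinearGroup.coe_mul, inv_mul_cancel_left]

lemma trace_neg_sl (x : SL(2, F)) : ((-x : SL(2, F)) : Matrix (Fin 2) (Fin 2) F).trace =
    -(x : Matrix (Fin 2) (Fin 2) F).trace := by
  rw [Matrix.SpecialLinearGroup.coe_neg, Matrix.trace_neg]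

/-- If a linear combination of `x` and the identity is zero, then `x` is central or the
coefficients vanish. -/
lemma eq_zero_of_smul_eq {x : SL(2, F)} (h1 : x ≠ 1) (h2 : x ≠ -1) {c d : F}
    (h : c • (x : Matrix (Fin 2) (Fin 2) F) = d • 1) : c = 0 ∧ d = 0 := by
  by_cases hc : c = 0
  · subst hc
    rw [zero_smul] at h
    have := congrFun (congrFun h 0) 0
    simp at this
    exact ⟨rfl, this.symm⟩
  · have hx : (x : Matrix (Fin 2) (Fin 2) F) = (c⁻¹ * d) • 1 := by
      rw [mul_smul, ← h, smul_smul, inv_mul_cancel₀ hc, one_smul]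
    exact ((smul_one_sl hx).elim h1 h2).elim

lemma coe_sq_eq (x : SL(2, F)) : ((x ^ 2 : SL(2, F)) : Matrix (Fin 2) (Fin 2) F) =
    (x : Matrix (Fin 2) (Fin 2) F).trace • (x : Matrix (Fin 2) (Fin 2) F) - 1 := by
  rw [Matrix.SpecialLinearGroup.coe_pow, sl_sq_eq]

lemma coe_pow_three_eq (x : SL(2, F)) : ((x ^ 3 : SL(2, F)) : Matrix (Fin 2) (Fin 2) F) =
    ((x : Matrix (Fin 2) (Fin 2) F).trace ^ 2 - 1) • (x : Matrix (Fin 2) (Fin 2) F) -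
      (x : Matrix (Fin 2) (Fin 2) F).trace • 1 := by
  rw [pow_succ, Matrix.SpecialLinearGroup.coe_mul, coe_sq_eq, Matrix.sub_mul, Matrix.smul_mul,
    ← pow_two, sl_sq_eq, Matrix.one_mul]
  module

lemma coe_pow_five_eq (x : SL(2, F)) : ((x ^ 5 : SL(2, F)) : Matrix (Fin 2) (Fin 2) F) =
    ((x : Matrix (Fin 2) (Fin 2) F).trace ^ 4 - 3 * (x : Matrix (Fin 2) (Fin 2) F).trace ^ 2 + 1) •
      (x : Matrix (Fin 2) (Fin 2) F) -
      ((x : Matrix (Fin 2) (Fin 2) F).trace ^ 3 -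
        2 * (x : Matrix (Fin 2) (Fin 2) F).trace) • 1 := by
  rw [show x ^ 5 = x ^ 3 * x ^ 2 from pow_add x 3 2, Matrix.SpecialLinearGroup.coe_mul, coe_sq_eq,
    coe_pow_three_eq, Matrix.sub_mul, Matrix.mul_sub, Matrix.mul_sub, Matrix.smul_mul,
    Matrix.smul_mul, Matrix.smul_mul, Matrix.smul_mul, Matrix.mul_smul, Matrix.mul_smul,
    ← pow_two, sl_sq_eq, Matrix.one_mul, Matrix.mul_one, Matrix.one_mul]
  module

lemma trace_eq_zero_iff {x : SL(2, F)} :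
    (x : Matrix (Fin 2) (Fin 2) F).trace = 0 ↔ x ^ 2 = -1 := by
  constructor
  · intro h
    apply sl_coe_injective
    rw [coe_sq_eq, h, zero_smul, zero_sub, Matrix.SpecialLinearGroup.coe_neg,
      Matrix.SpecialLinearGroup.coe_one]
  · intro h
    have h1 := congrArg (fun g : SL(2, F) => (g : Matrix (Fin 2) (Fin 2) F)) h
    simp only [coe_sq_eq, Matrix.SpecialLinearGroup.coe_neg,
      Matrix.SpecialLinearGroup.coe_one] at h1
    have h2 : (x : Matrix (Fin 2) (Fin 2) F).trace • (x : Matrix (Fin 2) (Fin 2) F) = 0 :=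
      sub_eq_neg_self.1 h1
    rcases smul_eq_zero.1 h2 with h3 | h3
    · exact h3
    · rw [h3]; simp

lemma trace_of_pow_three (h2 : (2 : F) ≠ 0) {x : SL(2, F)} (hx : x ^ 3 = 1) (h1 : x ≠ 1) :
    (x : Matrix (Fin 2) (Fin 2) F).trace = -1 := by
  have hx2 : x ≠ -1 := by
    rintro rfl
    rw [Odd.neg_one_pow (by decide)] at hx
    exact one_ne_neg_one_SL2 h2 hx.symm
  have h3 := coe_pow_three_eq x
  rw [hx, Matrix.SpecialLinearGroup.coe_one] at h3
  generalize (x : Matrix (Fin 2) (Fin 2) F).trace = t at *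
  have h4 : (t ^ 2 - 1) • (x : Matrix (Fin 2) (Fin 2) F) = (1 + t) • 1 := by
    rw [add_smul _ _ (1 : Matrix (Fin 2) (Fin 2) F), one_smul]
    exact sub_eq_iff_eq_add.1 h3.symm
  linear_combination (eq_zero_of_smul_eq h1 hx2 h4).2

lemma trace_of_pow_five (h2 : (2 : F) ≠ 0) {x : SL(2, F)} (hx : x ^ 5 = 1) (h1 : x ≠ 1) :
    (x : Matrix (Fin 2) (Fin 2) F).trace ^ 2 + (x : Matrix (Fin 2) (Fin 2) F).trace - 1 = 0 := by
  have hx2 : x ≠ -1 := by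
    rintro rfl
    rw [Odd.neg_one_pow (by decide)] at hx
    exact one_ne_neg_one_SL2 h2 hx.symm
  have h3 := coe_pow_five_eq x
  rw [hx, Matrix.SpecialLinearGroup.coe_one] at h3
  generalize (x : Matrix (Fin 2) (Fin 2) F).trace = t at *
  have h4 : (t ^ 4 - 3 * t ^ 2 + 1) • (x : Matrix (Fin 2) (Fin 2) F) =
      (1 + (t ^ 3 - 2 * t)) • 1 := by
    rw [add_smul _ _ (1 : Matrix (Fin 2) (Fin 2) F), one_smul]
    exact sub_eq_iff_eq_add.1 h3.symm
  obtain ⟨h5, h6⟩ := eq_zero_of_smul_eq h1 hx2 h4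
  have h7 : (t ^ 2 + t - 1) * (t ^ 2 - t - 1) = 0 := by linear_combination h5
  refine (mul_eq_zero.1 h7).resolve_right fun h8 => h2 ?_
  linear_combination h6 - (t + 1) * h8
end

/-! ### Normalizers of solvable groups of icosahedral elements -/

/-- A solvable group not contained in a given subgroup `Z` has a normal subgroup that is not
contained in `Z` but whose commutators all lie in `Z`. -/
lemma exists_normal_commutator_le {G : Type*} [Group G] [Group.IsSolvable G] {Z : Subgroup G}
    (hZ : ¬ ⊤ ≤ Z) : ∃ A : Subgroup G, A.Normal ∧ ¬ A ≤ Z ∧ ⁅A, A⁆ ≤ Z := by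
  classical
  have hex : ∃ n, derivedSeries G n ≤ Z := by
    obtain ⟨n, hn⟩ := Group.IsSolvable.solvable (G := G)
    exact ⟨n, hn ▸ bot_le⟩
  obtain ⟨m, hm⟩ : ∃ m, Nat.find hex = m + 1 := by
    refine Nat.exists_eq_succ_of_ne_zero fun h0 => hZ ?_
    have := Nat.find_spec hex
    rwa [h0, derivedSeries_zero] at this
  refine ⟨derivedSeries G m, derivedSeries_normal G m, Nat.find_min hex (by omega), ?_⟩
  have := Nat.find_spec hex
  rwa [hm, derivedSeries_succ] at this

/-- The elements whose image modulo `±1` has order `1`, `2`, `3` or `5`, as every element of a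
binary icosahedral group has. Elements with `k ^ 2 = 1` other than `±1` are left out: there are none
in `SL₂` over a field of odd characteristic. -/
def IsIcosahedralElement {G : Type*} [Group G] [HasDistribNeg G] (k : G) : Prop :=
  k = 1 ∨ k = -1 ∨ k ^ 2 = -1 ∨ k ^ 3 = 1 ∨ k ^ 3 = -1 ∨ k ^ 5 = 1 ∨ k ^ 5 = -1

section
variable {F : Type*} [Field F]

/-- Conjugation by `1 - x`, of determinant `2 - tr x`, fixes the elements that commute with `x`, and
multiplies those that invert `x` by `-x⁻¹` on the right. -/
lemma exists_conjSL_of_normalizes {K : Subgroup SL(2, F)} {x : SL(2, F)}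
    (hx : ¬ IsSquare (2 - (x : Matrix (Fin 2) (Fin 2) F).trace))
    (hK : ∀ k ∈ K, k * x = x * k ∨ k * x⁻¹ = x * k ∧ x ∈ K ∧ -1 ∈ K) :
    ∃ n : GL (Fin 2) F, ¬ IsSquare (n : Matrix (Fin 2) (Fin 2) F).det ∧
      ∀ k ∈ K, conjSL n k ∈ K := by
  have hdet : (1 - (x : Matrix (Fin 2) (Fin 2) F)).det =
      2 - (x : Matrix (Fin 2) (Fin 2) F).trace := by
    have := sl_det_eq x
    rw [sl_coe_eq x, Matrix.one_fin_two]
    simp [Matrix.det_fin_two, Matrix.trace_fin_two]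
    linear_combination this
  refine ⟨Matrix.GeneralLinearGroup.mkOfDetNeZero (1 - (x : Matrix (Fin 2) (Fin 2) F)) ?_, ?_, ?_⟩
  · rw [hdet]
    intro h0
    exact hx (h0 ▸ IsSquare.zero)
  · change ¬ IsSquare (1 - (x : Matrix (Fin 2) (Fin 2) F)).det
    rwa [hdet]
  · intro k hk
    rcases hK k hk with h | ⟨h, hxK, h1K⟩
    · rw [(conjSL_eq_iff (k := k)).2]
      · exact hk
      · change (1 - (x : Matrix (Fin 2) (Fin 2) F)) * (k : Matrix (Fin 2) (Fin 2) F) =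
          (k : Matrix (Fin 2) (Fin 2) F) * (1 - (x : Matrix (Fin 2) (Fin 2) F))
        rw [Matrix.sub_mul, Matrix.mul_sub, ← Matrix.SpecialLinearGroup.coe_mul,
          ← Matrix.SpecialLinearGroup.coe_mul, h, Matrix.one_mul, Matrix.mul_one]
    · rw [(conjSL_eq_iff (k := -1 * (k * x⁻¹))).2]
      · exact mul_mem h1K (mul_mem hk (inv_mem hxK))
      · change (1 - (x : Matrix (Fin 2) (Fin 2) F)) * (k : Matrix (Fin 2) (Fin 2) F) =
          ((-1 * (k * x⁻¹) : SL(2, F)) : Matrix (Fin 2) (Fin 2) F) *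
            (1 - (x : Matrix (Fin 2) (Fin 2) F))
        rw [neg_one_mul, Matrix.sub_mul, Matrix.mul_sub, ← Matrix.SpecialLinearGroup.coe_mul,
          ← Matrix.SpecialLinearGroup.coe_mul, neg_mul, inv_mul_cancel_right, h, Matrix.one_mul,
          Matrix.mul_one, Matrix.SpecialLinearGroup.coe_neg, Matrix.SpecialLinearGroup.coe_neg]
        abel

lemma sq_mul_comm_of_inverts {G : Type*} [Group G] {k x : G} (h : k * x⁻¹ = x * k) :
    k ^ 2 * x = x * k ^ 2 := by
  have h1 : k * x = x⁻¹ * k := by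
    rw [eq_inv_mul_iff_mul_eq, ← mul_assoc, ← h, inv_mul_cancel_right]
  rw [pow_two, mul_assoc, h1, ← mul_assoc, h, mul_assoc]

/-- An icosahedral element that inverts an element `x ≠ x⁻¹` has order four. -/
lemma IsIcosahedralElement.sq_eq_neg_one {G : Type*} [Group G] [HasDistribNeg G] {k x : G}
    (hk : IsIcosahedralElement k) (h : k * x⁻¹ = x * k) (hx : x ^ 2 ≠ 1) : k ^ 2 = -1 := by
  have hx' : ¬ k * x = x * k := by
    intro h'
    rw [← h', mul_right_inj, inv_eq_iff_mul_eq_one, ← pow_two] at h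
    exact hx h
  have h2 : Commute (k ^ 2) x := sq_mul_comm_of_inverts h
  have hone : ∀ y : G, y = 1 ∨ y = -1 → Commute y x := by
    rintro y (rfl | rfl)
    · exact Commute.one_left x
    · exact Commute.neg_one_left x
  -- an odd power of `k` that is central would force `k` to commute with `x`
  have h3 : ¬ (k ^ 3 = 1 ∨ k ^ 3 = -1) := by
    intro h3
    apply hx'
    have := (h2.inv_left.mul_left (hone _ h3)).eq
    rwa [show (k ^ 2)⁻¹ * k ^ 3 = k by group] at this
  have h5 : ¬ (k ^ 5 = 1 ∨ k ^ 5 = -1) := by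
    intro h5
    apply hx'
    have := ((h2.pow_left 2).inv_left.mul_left (hone _ h5)).eq
    rwa [show ((k ^ 2) ^ 2)⁻¹ * k ^ 5 = k by group] at this
  have h1 : ¬ (k = 1 ∨ k = -1) := fun h1 => hx' (hone _ h1).eq
  unfold IsIcosahedralElement at hk
  tauto

/-- A non-central icosahedral element not of order four is, up to sign, of order three or five. -/
lemma exists_odd_order_of_isIcosahedral {x : SL(2, F)} (hk : IsIcosahedralElement x) (h1 : x ≠ 1)
    (h2 : x ≠ -1) (h3 : x ^ 2 ≠ -1) :
    ∃ y, (y = x ∨ y = -x) ∧ y ≠ 1 ∧ (y ^ 3 = 1 ∨ y ^ 5 = 1) := by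
  rcases hk with h | h | h | h | h | h | h
  · exact absurd h h1
  · exact absurd h h2
  · exact absurd h h3
  · exact ⟨x, Or.inl rfl, h1, Or.inl h⟩
  · exact ⟨-x, Or.inr rfl, fun h' => h2 (by rw [← h', neg_neg]),
      Or.inl (by rw [Odd.neg_pow (by decide), h, neg_neg])⟩
  · exact ⟨x, Or.inl rfl, h1, Or.inr h⟩
  · exact ⟨-x, Or.inr rfl, fun h' => h2 (by rw [← h', neg_neg]),
      Or.inr (by rw [Odd.neg_pow (by decide), h, neg_neg])⟩

/-- The arithmetic conditions on a field under which the maximal solvable subgroups of a binary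
icosahedral group are normalized by matrices of non-square determinant: the values `2 - t`, for
`t` the trace of an element of order `4`, `3` or `5`, are not squares. -/
structure ScottField (F : Type*) [Field F] : Prop where
  two : ¬ IsSquare (2 : F)
  three : ¬ IsSquare (3 : F)
  five : ∀ t : F, t ^ 2 + t - 1 = 0 → ¬ IsSquare (2 - t)
  five_ne_zero : (5 : F) ≠ 0

lemma ScottField.two_ne_zero (hF : ScottField F) : (2 : F) ≠ 0 :=
  fun h => hF.two (h ▸ IsSquare.zero)

lemma ScottField.three_ne_zero (hF : ScottField F) : (3 : F) ≠ 0 :=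
  fun h => hF.three (h ▸ IsSquare.zero)

/-- Let `K` be a group of icosahedral elements containing `x` or `-x`, where `x` of order three or
five commutes up to sign with its conjugates under `K`. As `x` has nonzero trace, it commutes with
them, so they are `x` or `x⁻¹`, and `1 - x` normalizes `K`. -/
lemma exists_conjSL_of_odd_order (hF : ScottField F) {K : Subgroup SL(2, F)}
    (hK : ∀ k ∈ K, IsIcosahedralElement k) {x : SL(2, F)} (hxK : x ∈ K ∨ -x ∈ K) (hx1 : x ≠ 1)
    (hx : x ^ 3 = 1 ∨ x ^ 5 = 1)
    (hcomm : ∀ k ∈ K, x * (k * x * k⁻¹) = k * x * k⁻¹ * x ∨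
      x * (k * x * k⁻¹) = -(k * x * k⁻¹ * x)) :
    ∃ n : GL (Fin 2) F, ¬ IsSquare (n : Matrix (Fin 2) (Fin 2) F).det ∧
      ∀ k ∈ K, conjSL n k ∈ K := by
  have h2 := hF.two_ne_zero
  obtain ⟨hsq, h0, h4⟩ : ¬ IsSquare (2 - (x : Matrix (Fin 2) (Fin 2) F).trace) ∧
      (x : Matrix (Fin 2) (Fin 2) F).trace ≠ 0 ∧
      (x : Matrix (Fin 2) (Fin 2) F).trace ^ 2 ≠ 4 := by
    rcases hx with hx | hx
    · rw [trace_of_pow_three h2 hx hx1]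
      refine ⟨by rw [show (2 - -1 : F) = 3 by norm_num]; exact hF.three, by simp, fun h => ?_⟩
      exact hF.three_ne_zero (by linear_combination -h)
    · have ht := trace_of_pow_five h2 hx hx1
      generalize (x : Matrix (Fin 2) (Fin 2) F).trace = t at *
      refine ⟨hF.five t ht, ?_, fun h => hF.five_ne_zero ?_⟩
      · rintro rfl
        simp at ht
      · linear_combination (3 - t) * ht + (t - 2) * h
  have hxsq : x ^ 2 ≠ 1 := by
    intro hxsq
    apply hx1
    rcases hx with hx | hx
    · rwa [pow_succ, hxsq, one_mul] at hx
    · rwa [show x ^ 5 = x ^ 2 * x ^ 2 * x by group, hxsq, one_mul, one_mul] at hx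
  refine exists_conjSL_of_normalizes hsq fun k hk => ?_
  have hc : x * (k * x * k⁻¹) = k * x * k⁻¹ * x := by
    refine (hcomm k hk).resolve_right fun h => h0 ?_
    have h3 : x = -(k * x * k⁻¹ * x * (k * x * k⁻¹)⁻¹) := by
      rw [← neg_mul, ← h, mul_inv_cancel_right]
    have h4 := trace_sl_conj (k * x * k⁻¹) x
    rw [← neg_eq_iff_eq_neg.2 h3, trace_neg_sl] at h4
    have h5 : 2 * (x : Matrix (Fin 2) (Fin 2) F).trace = 0 := by linear_combination -h4
    exact (mul_eq_zero.1 h5).resolve_left h2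
  rcases eq_or_eq_inv_of_commute h2 hc (trace_sl_conj k x) h4 with h | h
  · left
    rwa [mul_inv_eq_iff_eq_mul] at h
  · right
    have h' : k * x⁻¹ = x * k := by
      rw [mul_inv_eq_iff_eq_mul, eq_inv_mul_iff_mul_eq] at h
      rw [mul_inv_eq_iff_eq_mul, mul_assoc, h]
    have h1K : -1 ∈ K := (hK k hk).sq_eq_neg_one h' hxsq ▸ pow_mem hk 2
    refine ⟨h', ?_, h1K⟩
    refine hxK.elim id fun hx' => ?_
    have := mul_mem h1K hx'
    rwa [neg_one_mul, neg_neg] at this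

/-- Elements of order four that commute are equal up to sign. -/
lemma eq_or_eq_neg_of_sq (h2 : (2 : F) ≠ 0) {x y : SL(2, F)} (hx : x ^ 2 = -1) (hy : y ^ 2 = -1)
    (h : x * y = y * x) : y = x ∨ y = -x := by
  have h4 : (4 : F) ≠ 0 := by
    rw [show (4 : F) = 2 * 2 by norm_num]
    exact mul_ne_zero h2 h2
  have htx := trace_eq_zero_iff.2 hx
  have hinv : x⁻¹ = -x := by
    rw [inv_eq_iff_mul_eq_one, mul_neg, ← pow_two, hx, neg_neg]
  rw [← hinv]
  apply eq_or_eq_inv_of_commute h2 h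
  · rw [htx, trace_eq_zero_iff.2 hy]
  · rw [htx, zero_pow two_ne_zero]
    exact h4.symm

/-- The centralizer of a quaternion group is the center. -/
lemma eq_one_or_neg_one_of_commute (h2 : (2 : F) ≠ 0) {i j g : SL(2, F)} (hij : i * j = -(j * i))
    (hi : g * i = i * g) (hj : g * j = j * g) : g = 1 ∨ g = -1 := by
  have hne : ∀ x : SL(2, F), x ≠ -x := by
    intro x hx
    apply one_ne_neg_one_SL2 h2
    rw [← mul_left_inj x, one_mul, neg_one_mul]
    exact hx
  have hi1 : i ≠ 1 := by
    rintro rfl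
    rw [one_mul, mul_one] at hij
    exact hne j hij
  have hi2 : i ≠ -1 := by
    rintro rfl
    rw [neg_one_mul, mul_neg_one, neg_neg] at hij
    exact hne j hij.symm
  obtain ⟨α, β, hg⟩ := exists_eq_add_smul_of_commute hi1 hi2
    (congrArg (fun g : SL(2, F) => (g : Matrix (Fin 2) (Fin 2) F)) hi.symm)
  have hj' := congrArg (fun g : SL(2, F) => (g : Matrix (Fin 2) (Fin 2) F)) hj
  simp only [Matrix.SpecialLinearGroup.coe_mul, hg, Matrix.add_mul, Matrix.mul_add,
    Matrix.smul_mul, Matrix.mul_smul, Matrix.one_mul, Matrix.mul_one] at hj'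
  rw [← Matrix.SpecialLinearGroup.coe_mul, hij, Matrix.SpecialLinearGroup.coe_neg,
    ← Matrix.SpecialLinearGroup.coe_mul] at hj'
  have h3 : (2 * β) • ((j * i : SL(2, F)) : Matrix (Fin 2) (Fin 2) F) = 0 := by
    have := add_left_cancel hj'
    rw [mul_smul, two_smul]
    nth_rw 1 [← this]
    module
  have hβ : β = 0 := by
    rcases smul_eq_zero.1 h3 with h3 | h3
    · exact (mul_eq_zero.1 h3).resolve_left h2
    · have := (j * i).2
      rw [h3] at this
      simp at this
  rw [hβ, zero_smul, add_zero] at hg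
  exact smul_one_sl hg

end

section
variable {G : Type*} [Group G] [HasDistribNeg G]

lemma not_isIcosahedral_of_anticommute_sq (hne : ∀ x : G, x ≠ -x) {j k : G}
    (hk : IsIcosahedralElement k) (h : k ^ 2 * j = -(j * k ^ 2)) : False := by
  have hnc : ¬ Commute (k ^ 2) j := fun hc => hne (j * k ^ 2) (by rw [← h]; exact hc.eq.symm)
  have h4 : Commute (k ^ 4) j := by
    change k ^ 4 * j = j * k ^ 4
    rw [show k ^ 4 = k ^ 2 * k ^ 2 from pow_add k 2 2, mul_assoc, h, mul_neg, ← mul_assoc, h,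
      neg_mul, neg_neg, mul_assoc]
  have hone : ∀ y : G, y = 1 ∨ y = -1 → Commute y j := by
    rintro y (rfl | rfl)
    · exact Commute.one_left j
    · exact Commute.neg_one_left j
  have h3 : ¬ (k ^ 3 = 1 ∨ k ^ 3 = -1) := by
    intro h3
    have := (hone _ h3).inv_left.mul_left h4
    rw [show (k ^ 3)⁻¹ * k ^ 4 = k by group] at this
    exact hnc (this.pow_left 2)
  have h5 : ¬ (k ^ 5 = 1 ∨ k ^ 5 = -1) := by
    intro h5
    have := h4.inv_left.mul_left (hone _ h5)
    rw [show (k ^ 4)⁻¹ * k ^ 5 = k by group] at this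
    exact hnc (this.pow_left 2)
  have h1 : ¬ (k = 1 ∨ k = -1) := fun h1 => hnc ((hone _ h1).pow_left 2)
  have h2 : k ^ 2 ≠ -1 := fun h2 => hnc (hone _ (Or.inr h2))
  unfold IsIcosahedralElement at hk
  tauto

/-- No icosahedral element fixes one axis of a quaternion group and exchanges the other two, where
the axes are the pairs `±i`, `±j`, `±(i * j)`: the element or its product with `j` would have order
eight. -/
lemma not_isIcosahedral_of_swap (hne : ∀ x : G, x ≠ -x) {i j k : G} (hi : i * i = -1)
    (hij : j * i = -(i * j)) (hk : IsIcosahedralElement k)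
    (hkj : IsIcosahedralElement (k * j)) (h1 : k * i = i * k ∨ k * i = -(i * k))
    (h2 : k * j = i * j * k ∨ k * j = -(i * j * k)) : False := by
  have key : ∀ k : G, IsIcosahedralElement k → k * i = i * k →
      (k * j = i * j * k ∨ k * j = -(i * j * k)) → False := by
    intro k hk h1 h2
    apply not_isIcosahedral_of_anticommute_sq hne hk (j := j)
    rcases h2 with h2 | h2
    · calc k ^ 2 * j = k * (k * j) := by rw [pow_two, mul_assoc]
        _ = (k * i) * (j * k) := by rw [h2]; simp only [mul_assoc]
        _ = i * (k * j) * k := by rw [h1]; simp only [mul_assoc]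
        _ = i * i * (j * k * k) := by rw [h2]; simp only [mul_assoc]
        _ = -(j * k ^ 2) := by rw [hi, neg_one_mul, pow_two, mul_assoc]
    · calc k ^ 2 * j = k * (k * j) := by rw [pow_two, mul_assoc]
        _ = -((k * i) * (j * k)) := by rw [h2, mul_neg]; simp only [mul_assoc]
        _ = -(i * (k * j) * k) := by rw [h1]; simp only [mul_assoc]
        _ = i * i * (j * k * k) := by
          rw [h2, mul_neg, neg_mul, neg_neg]; simp only [mul_assoc]
        _ = -(j * k ^ 2) := by rw [hi, neg_one_mul, pow_two, mul_assoc]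
  rcases h1 with h1 | h1
  · exact key k hk h1 h2
  · refine key (k * j) hkj ?_ ?_
    · rw [mul_assoc, hij, mul_neg, ← mul_assoc, h1, neg_mul, neg_neg, mul_assoc]
    · rcases h2 with h2 | h2
      · left; rw [h2, ← h2, mul_assoc, ← mul_assoc (i * j), ← h2]; simp only [mul_assoc]
      · right; nth_rw 1 [h2]; rw [neg_mul, mul_assoc (i * j)]

end

section
variable {F : Type*} [Field F]

/-- The binary tetrahedral case: the quaternion group `⟨i, j⟩` is normal in `K`, and some element
of `K` does not normalize `⟨i⟩`. Then `K` is generated by `i`, `j` and an element `w` permuting the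
three axes cyclically, and `1 + i`, of determinant two, normalizes `K`. -/
lemma exists_conjSL_of_quaternion (hF : ScottField F) {K A : Subgroup SL(2, F)} (hAK : A ≤ K)
    (hnorm : ∀ k ∈ K, ∀ a ∈ A, k * a * k⁻¹ ∈ A)
    (hcomm : ∀ a ∈ A, ∀ b ∈ A, a * b = b * a ∨ a * b = -(b * a))
    (hK : ∀ k ∈ K, IsIcosahedralElement k) {i k₀ : SL(2, F)} (hiA : i ∈ A) (hi : i ^ 2 = -1)
    (hk₀ : k₀ ∈ K) (hki : k₀ * i ≠ i * k₀) (hki' : k₀ * i ≠ -(i * k₀)) :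
    ∃ n : GL (Fin 2) F, ¬ IsSquare (n : Matrix (Fin 2) (Fin 2) F).det ∧
      ∀ k ∈ K, conjSL n k ∈ K := by
  have h2 := hF.two_ne_zero
  have hne : ∀ x : SL(2, F), x ≠ -x := by
    intro x hx
    apply one_ne_neg_one_SL2 h2
    rw [← mul_left_inj x, one_mul, neg_one_mul]
    exact hx
  have hii : i * i = -1 := by rw [← pow_two, hi]
  obtain ⟨j, hj⟩ : ∃ j, j = k₀ * i * k₀⁻¹ := ⟨_, rfl⟩
  have hjA : j ∈ A := hj ▸ hnorm k₀ hk₀ i hiA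
  have hk1 : k₀ * i = j * k₀ := by rw [hj, inv_mul_cancel_right]
  -- conjugates of elements of order four have order four
  have hconj : ∀ k a : SL(2, F), a ^ 2 = -1 → (k * a * k⁻¹) ^ 2 = -1 := by
    intro k a ha
    rw [conj_pow, ha, mul_neg_one, neg_mul, mul_inv_cancel]
  have hj2 : j ^ 2 = -1 := hj ▸ hconj k₀ i hi
  have hjj : j * j = -1 := by rw [← pow_two, hj2]
  have hij : i * j = -(j * i) := by
    refine (hcomm i hiA j hjA).resolve_left fun h => ?_
    rcases eq_or_eq_neg_of_sq h2 hi hj2 h with h | h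
    · exact hki (by rw [hk1, h])
    · exact hki' (by rw [hk1, h, neg_mul])
  have hji : j * i = -(i * j) := by rw [hij, neg_neg]
  have hijA : i * j ∈ A := mul_mem hiA hjA
  have hij2 : (i * j) ^ 2 = -1 := by
    rw [pow_two, mul_assoc, ← mul_assoc j, hji, neg_mul, mul_neg, mul_assoc, hjj, ← mul_assoc, hii]
    simp
  have h1K : (-1 : SL(2, F)) ∈ K := hii ▸ mul_mem (hAK hiA) (hAK hiA)
  -- the axes of the quaternion group are the only elements of order four in `A`
  have haxes : ∀ c ∈ A, c ^ 2 = -1 →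
      (c = i ∨ c = -i) ∨ (c = j ∨ c = -j) ∨ (c = i * j ∨ c = -(i * j)) := by
    intro c hc hc2
    rcases hcomm i hiA c hc with h | h
    · exact Or.inl (eq_or_eq_neg_of_sq h2 hi hc2 h)
    rcases hcomm j hjA c hc with h' | h'
    · exact Or.inr (Or.inl (eq_or_eq_neg_of_sq h2 hj2 hc2 h'))
    refine Or.inr (Or.inr (eq_or_eq_neg_of_sq h2 hij2 hc2 ?_))
    rw [mul_assoc, h', mul_neg, ← mul_assoc, h, neg_mul, neg_neg, mul_assoc]
  have hji' : j ≠ i ∧ j ≠ -i := by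
    constructor
    · rintro rfl
      exact hne _ hij
    · rintro rfl
      rw [neg_mul, mul_neg] at hij
      exact hne _ hij
  have hiji : i * j * i = j := by
    rw [mul_assoc, hji, mul_neg, ← mul_assoc, hii, neg_one_mul, neg_neg]
  have hjij : j * (i * j) = i := by
    rw [← mul_assoc, hji, neg_mul, mul_assoc, hjj, mul_neg_one, neg_neg]
  -- after multiplication by `i`, the element `k₀` permutes the axes cyclically
  obtain ⟨w, hw, hwi, hwj⟩ : ∃ w ∈ K, w * i = j * w ∧ w * j = i * j * w := by
    have hl2 := hconj k₀ j hj2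
    have hl := haxes _ (hnorm k₀ hk₀ j hjA) hl2
    rcases hl with hl | hl | hl
    · -- exchanging two axes is impossible
      exfalso
      rw [mul_inv_eq_iff_eq_mul, mul_inv_eq_iff_eq_mul, neg_mul] at hl
      refine not_isIcosahedral_of_swap hne (i := i * j) (j := i) (k := k₀)
        (by rw [← pow_two, hij2]) ?_ (hK _ hk₀) (hK _ (mul_mem hk₀ (hAK hiA))) ?_ ?_
      · rw [hiji, ← mul_assoc, hii, neg_one_mul]
      · rw [← mul_assoc, hk1, mul_assoc]
        rcases hl with hl | hl <;> rw [hl]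
        · right; rw [← mul_assoc, hji, neg_mul]
        · left; rw [mul_neg, ← mul_assoc, hji, neg_mul, neg_neg]
      · left; rw [hiji, hk1]
    · exfalso
      rw [mul_inv_eq_iff_eq_mul, mul_inv_eq_iff_eq_mul, neg_mul, ← hk1, ← mul_neg,
        mul_right_inj, mul_right_inj] at hl
      exact hl.elim hji'.1 hji'.2
    · rw [mul_inv_eq_iff_eq_mul, mul_inv_eq_iff_eq_mul, neg_mul] at hl
      rcases hl with hl | hl
      · exact ⟨k₀, hk₀, hk1, hl⟩
      · refine ⟨k₀ * i, mul_mem hk₀ (hAK hiA), ?_, ?_⟩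
        · rw [hk1, mul_assoc, hk1]
        · calc k₀ * i * j = -(k₀ * j * i) := by rw [mul_assoc, hij, mul_neg, mul_assoc]
            _ = i * j * (k₀ * i) := by rw [hl, neg_mul, neg_neg, mul_assoc]
  have hwij : w * (i * j) = i * w := by
    rw [← mul_assoc, hwi, mul_assoc, hwj, ← mul_assoc, ← mul_assoc, hji, neg_mul, mul_assoc i,
      hjj, mul_neg_one, neg_neg]
  have hw1 : w⁻¹ * j = i * w⁻¹ := by
    rw [inv_mul_eq_iff_eq_mul, ← mul_assoc, hwi, mul_inv_cancel_right]
  have hw2 : w⁻¹ * (i * j) = j * w⁻¹ := by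
    rw [inv_mul_eq_iff_eq_mul, ← mul_assoc, hwj, mul_inv_cancel_right]
  have hdet : (1 + (i : Matrix (Fin 2) (Fin 2) F)).det = 2 := by
    have h3 := trace_eq_zero_iff.2 hi
    have h4 := sl_det_eq i
    rw [sl_coe_eq i] at h3 ⊢
    rw [Matrix.one_fin_two]
    simp [Matrix.det_fin_two, Matrix.trace_fin_two] at h3 ⊢
    linear_combination h3 + h4
  obtain ⟨n, hn⟩ : ∃ n : GL (Fin 2) F, (n : Matrix (Fin 2) (Fin 2) F) = 1 + i :=
    ⟨Matrix.GeneralLinearGroup.mkOfDetNeZero _ (by rw [hdet]; exact h2), rfl⟩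
  refine ⟨n, by rw [hn, hdet]; exact hF.two, ?_⟩
  have hni : conjSL n i = i := by
    rw [conjSL_eq_iff, hn, Matrix.add_mul, Matrix.mul_add, Matrix.one_mul, Matrix.mul_one]
  have hnj : conjSL n j = i * j := by
    rw [conjSL_eq_iff, hn, Matrix.add_mul, Matrix.mul_add, Matrix.one_mul, Matrix.mul_one,
      ← Matrix.SpecialLinearGroup.coe_mul, ← Matrix.SpecialLinearGroup.coe_mul, mul_assoc, hji,
      mul_neg, ← mul_assoc, hii, neg_one_mul, neg_neg, add_comm]
  -- up to sign, an element is determined by its action on `i` and `j`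
  have hnw : conjSL n w = w⁻¹ * i ∨ conjSL n w = -(w⁻¹ * i) := by
    have u1 : conjSL n w * i = i * j * conjSL n w := by
      have := congrArg (conjSL n) hwi
      rwa [map_mul, map_mul, hni, hnj] at this
    have u2 : conjSL n w * j = -i * conjSL n w := by
      have h3 := congrArg (conjSL n) hwij
      rw [map_mul, map_mul, map_mul, hni, hnj, ← mul_assoc i, hii, neg_one_mul, mul_neg] at h3
      rw [neg_mul, ← h3, neg_neg]
    have v1 : w⁻¹ * i * i = i * j * (w⁻¹ * i) := by
      rw [mul_assoc i j, ← mul_assoc j, ← hw2, mul_assoc w⁻¹ (i * j), hiji, ← mul_assoc i, ← hw1,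
        mul_assoc, mul_assoc, hii, hjj]
    have v2 : w⁻¹ * i * j = -i * (w⁻¹ * i) := by
      rw [neg_mul, ← mul_assoc, ← hw1, mul_assoc, mul_assoc, hji, mul_neg, neg_neg]
    have hc : ∀ {a b : SL(2, F)}, conjSL n w * a = b * conjSL n w → w⁻¹ * i * a = b * (w⁻¹ * i) →
        (w⁻¹ * i)⁻¹ * conjSL n w * a = a * ((w⁻¹ * i)⁻¹ * conjSL n w) := by
      intro a b h3 h4
      exact (SemiconjBy.inv_symm_left (show SemiconjBy (w⁻¹ * i) a b from h4)).mul_left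
        (show SemiconjBy (conjSL n w) a b from h3)
    rcases eq_one_or_neg_one_of_commute h2 hij (hc u1 v1) (hc u2 v2) with h3 | h3
    · left; rw [inv_mul_eq_one] at h3; exact h3.symm
    · right; rw [inv_mul_eq_iff_eq_mul] at h3; rw [h3, mul_neg_one]
  obtain ⟨S, hS⟩ : ∃ S : Subgroup SL(2, F), ∀ k, k ∈ S ↔ conjSL n k ∈ K :=
    ⟨K.comap (conjSL n).toMonoidHom, fun _ => Iff.rfl⟩
  have hSi : i ∈ S := by rw [hS, hni]; exact hAK hiA
  have hSj : j ∈ S := by rw [hS, hnj]; exact hAK hijA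
  have hS1 : -1 ∈ S := by rw [hS, conjSL_neg_one]; exact h1K
  have hSw : w ∈ S := by
    rw [hS]
    have h3 := mul_mem (inv_mem hw) (hAK hiA)
    rcases hnw with h | h <;> rw [h]
    · exact h3
    · rw [← neg_one_mul]
      exact mul_mem h1K h3
  -- the elements of `K` fixing all axes lie in the quaternion group
  have hfix : ∀ k ∈ K, (k * i = i * k ∨ k * i = -(i * k)) → (k * j = j * k ∨ k * j = -(j * k)) →
      k ∈ S := by
    intro k hk h3 h4
    have hq : ∀ q ∈ S, (k * q) * i = i * (k * q) → (k * q) * j = j * (k * q) → k ∈ S := by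
      intro q hq h5 h6
      have h7 : k * q ∈ S := by
        rcases eq_one_or_neg_one_of_commute h2 hij h5 h6 with h | h <;> rw [h]
        · exact one_mem S
        · exact hS1
      have := mul_mem h7 (inv_mem hq)
      rwa [mul_inv_cancel_right] at this
    rcases h3 with h3 | h3 <;> rcases h4 with h4 | h4
    · exact hq 1 (one_mem S) (by simpa using h3) (by simpa using h4)
    · refine hq i hSi ?_ ?_
      · rw [h3, mul_assoc, h3]
      · rw [mul_assoc, hij, mul_neg, ← mul_assoc, h4, neg_mul, neg_neg, mul_assoc]
    · refine hq j hSj ?_ ?_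
      · rw [mul_assoc, hji, mul_neg, ← mul_assoc, h3, neg_mul, neg_neg, mul_assoc]
      · rw [h4, mul_assoc, h4]
    · refine hq (i * j) (mul_mem hSi hSj) ?_ ?_
      · rw [mul_assoc k, mul_assoc i, hji, mul_neg, mul_neg, ← mul_assoc k, h3]
        simp only [neg_mul, neg_neg, mul_assoc]
      · have h5 : j * k = -(k * j) := by rw [h4, neg_neg]
        rw [← mul_assoc j, h5, neg_mul, mul_assoc k j, hjij, mul_assoc k, mul_assoc i, hjj,
          mul_neg_one, mul_neg]
  have haxis : ∀ k ∈ K, (k * i = i * k ∨ k * i = -(i * k)) → k ∈ S := by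
    intro k hk h3
    have h4 := haxes _ (hnorm k hk j hjA) (hconj k j hj2)
    simp only [mul_inv_eq_iff_eq_mul] at h4
    simp only [neg_mul] at h4
    rcases h4 with h4 | h4 | h4
    · exfalso
      have h5 : k * j = k * i ∨ k * j = k * -i := by
        rw [mul_neg]
        rcases h3 with h3 | h3 <;> rcases h4 with h4 | h4 <;> rw [h3, h4] <;> simp
      rw [mul_right_inj, mul_right_inj] at h5
      exact h5.elim hji'.1 hji'.2
    · exact hfix k hk h3 h4
    · exact (not_isIcosahedral_of_swap hne hii hji (hK _ hk) (hK _ (mul_mem hk (hAK hjA))) h3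
        h4).elim
  -- every element of `K` fixes the axis `±i` after multiplication by a power of `w`
  intro k hk
  rw [← hS]
  have hwk : ∀ l, (w⁻¹ * l ∈ S → l ∈ S) := fun l hl => by
    have := mul_mem hSw hl
    rwa [mul_inv_cancel_left] at this
  have hj_axis : ∀ k ∈ K, (k * i = j * k ∨ k * i = -(j * k)) → k ∈ S := by
    intro k hk h3
    refine hwk k (haxis _ (mul_mem (inv_mem hw) hk) ?_)
    rw [mul_assoc, ← mul_assoc i, ← hw1, mul_assoc w⁻¹ j]
    exact h3.imp (fun h => by rw [h]) (fun h => by rw [h, mul_neg])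
  have h4 := haxes _ (hnorm k hk i hiA) (hconj k i hi)
  simp only [mul_inv_eq_iff_eq_mul] at h4
  simp only [neg_mul] at h4
  rcases h4 with h4 | h4 | h4
  · exact haxis k hk h4
  · exact hj_axis k hk h4
  · refine hwk k (hj_axis _ (mul_mem (inv_mem hw) hk) ?_)
    rw [mul_assoc, ← mul_assoc j, ← hw2, mul_assoc w⁻¹ (i * j)]
    exact h4.imp (fun h => by rw [h]) (fun h => by rw [h, mul_neg])
end

lemma commute_or_anticommute {G : Type*} [Group G] [HasDistribNeg G] {a b : G}
    (h : a * b * a⁻¹ * b⁻¹ = 1 ∨ a * b * a⁻¹ * b⁻¹ = -1) : a * b = b * a ∨ a * b = -(b * a) := by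
  rwa [mul_inv_eq_iff_eq_mul, mul_inv_eq_iff_eq_mul, mul_inv_eq_iff_eq_mul,
    mul_inv_eq_iff_eq_mul, one_mul, neg_one_mul, neg_mul] at h

section
variable {F : Type*} [Field F]

/-- Every solvable group of icosahedral elements is normalized by a matrix whose determinant is
not a square. A noncentral normal subgroup `A` that is commutative modulo `±1` either contains an
element of order three or five up to sign, or consists of elements of order dividing four. In the
latter case the group normalizes `⟨i⟩` for an element `i` of order four in `A`, or it moves `i`
inside the quaternion group `A`. -/
theorem exists_conjSL_of_isSolvable (hF : ScottField F) (K : Subgroup SL(2, F))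
    [Group.IsSolvable K] (hK : ∀ k ∈ K, IsIcosahedralElement k) :
    ∃ n : GL (Fin 2) F, ¬ IsSquare (n : Matrix (Fin 2) (Fin 2) F).det ∧
      ∀ k ∈ K, conjSL n k ∈ K := by
  have h2 := hF.two_ne_zero
  by_cases hZ : (⊤ : Subgroup K) ≤ (Subgroup.center SL(2, F)).subgroupOf K
  -- a central group is normalized by every matrix, for example by `1 - x` with `x` of order four
  · refine exists_conjSL_of_normalizes (x := ⟨!![0, -1; 1, 0], by simp⟩) (by simpa using hF.two) ?_
    intro k hk
    left
    have : k ∈ Subgroup.center SL(2, F) := hZ (Subgroup.mem_top (⟨k, hk⟩ : K))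
    exact (Subgroup.mem_center_iff.1 this _).symm
  obtain ⟨A₀, hA₀, hAZ, hAA⟩ := exists_normal_commutator_le hZ
  obtain ⟨A, hA⟩ : ∃ A, A = A₀.map K.subtype := ⟨_, rfl⟩
  have hAK : A ≤ K := by rw [hA]; exact Subgroup.map_subtype_le A₀
  have hnorm : ∀ k ∈ K, ∀ a ∈ A, k * a * k⁻¹ ∈ A := by
    rw [hA]
    rintro k hk _ ⟨a, ha, rfl⟩
    exact ⟨(⟨k, hk⟩ : K) * a * (⟨k, hk⟩ : K)⁻¹, hA₀.conj_mem a ha _, rfl⟩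
  have hcomm : ∀ a ∈ A, ∀ b ∈ A, a * b = b * a ∨ a * b = -(b * a) := by
    rw [hA]
    rintro _ ⟨a, ha, rfl⟩ _ ⟨b, hb, rfl⟩
    have h3 : (a : SL(2, F)) * b * (a : SL(2, F))⁻¹ * (b : SL(2, F))⁻¹ ∈ Subgroup.center SL(2, F) :=
      hAA (Subgroup.commutator_mem_commutator ha hb)
    exact commute_or_anticommute (mem_center_SL2_iff.1 h3)
  by_cases hsq : ∀ a ∈ A, a = 1 ∨ a = -1 ∨ a ^ 2 = -1
  · obtain ⟨i, hiA, hi⟩ : ∃ i ∈ A, i ^ 2 = -1 := by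
      obtain ⟨a, ha, haZ⟩ := SetLike.not_le_iff_exists.1 hAZ
      have haZ' : ¬ ((a : SL(2, F)) = 1 ∨ (a : SL(2, F)) = -1) :=
        fun h => haZ (mem_center_SL2_iff.2 h)
      push Not at haZ'
      have haA : (a : SL(2, F)) ∈ A := by rw [hA]; exact ⟨a, ha, rfl⟩
      exact ⟨a, haA, ((hsq a haA).resolve_left haZ'.1).resolve_left haZ'.2⟩
    by_cases hall : ∀ k ∈ K, k * i = i * k ∨ k * i = -(i * k)
    · refine exists_conjSL_of_normalizes (x := i) ?_ fun k hk => ?_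
      · rw [trace_eq_zero_iff.2 hi, sub_zero]
        exact hF.two
      · refine (hall k hk).imp_right fun h => ⟨?_, hAK hiA, hi ▸ pow_mem (hAK hiA) 2⟩
        have hinv : i⁻¹ = -i := by
          rw [inv_eq_iff_mul_eq_one, mul_neg, ← pow_two, hi, neg_neg]
        rw [hinv, mul_neg, h, neg_neg]
    · push Not at hall
      obtain ⟨k₀, hk₀, h3, h4⟩ := hall
      exact exists_conjSL_of_quaternion hF hAK hnorm hcomm hK hiA hi hk₀ h3 h4
  · push Not at hsq
    obtain ⟨a, haA, ha1, ha2, ha3⟩ := hsq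
    obtain ⟨x, hx, hx1, hx35⟩ := exists_odd_order_of_isIcosahedral (hK a (hAK haA)) ha1 ha2 ha3
    refine exists_conjSL_of_odd_order hF hK ?_ hx1 hx35 fun k hk => ?_
    · rcases hx with rfl | rfl
      · exact Or.inl (hAK haA)
      · right; rw [neg_neg]; exact hAK haA
    · have h3 := hcomm a haA _ (hnorm k hk a haA)
      rcases hx with rfl | rfl
      · exact h3
      · simpa only [mul_neg, neg_mul, neg_neg] using h3

/-- Conjugation by a matrix of square determinant is an inner automorphism of `SL₂`. -/
lemma exists_conjSL_eq_of_isSquare {m : GL (Fin 2) F}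
    (hm : IsSquare (m : Matrix (Fin 2) (Fin 2) F).det) :
    ∃ g : SL(2, F), ∀ x, conjSL m x = g * x * g⁻¹ := by
  obtain ⟨s, hs⟩ := hm
  have hm0 : (m : Matrix (Fin 2) (Fin 2) F).det ≠ 0 := Matrix.GeneralLinearGroup.det_ne_zero m
  have hs0 : s ≠ 0 := by
    rintro rfl
    exact hm0 (by rw [hs, zero_mul])
  obtain ⟨g, hg⟩ : ∃ g : SL(2, F), (g : Matrix (Fin 2) (Fin 2) F) =
      s⁻¹ • (m : Matrix (Fin 2) (Fin 2) F) := by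
    refine ⟨⟨s⁻¹ • (m : Matrix (Fin 2) (Fin 2) F), ?_⟩, rfl⟩
    rw [Matrix.det_smul, hs, Fintype.card_fin]
    field_simp
  refine ⟨g, fun x => ?_⟩
  rw [eq_mul_inv_iff_mul_eq]
  apply sl_coe_injective
  rw [Matrix.SpecialLinearGroup.coe_mul, Matrix.SpecialLinearGroup.coe_mul, hg, Matrix.mul_smul,
    Matrix.smul_mul, (conjSL_eq_iff (n := m) (g := x)).1 rfl]

lemma isSquare_mul_of_not_isSquare [Finite F] {a b : F} (ha : ¬ IsSquare a) (hb : ¬ IsSquare b) :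
    IsSquare (a * b) := by
  classical
  have := Fintype.ofFinite F
  rw [← quadraticChar_neg_one_iff_not_isSquare] at ha hb
  have h0 : a * b ≠ 0 := by
    rintro h
    rcases mul_eq_zero.1 h with rfl | rfl <;> simp at ha hb
  rw [← quadraticChar_one_iff_isSquare h0, map_mul, ha, hb]
  rfl

/-- Conjugation by a matrix of non-square determinant maps every solvable group of icosahedral
elements to a conjugate in `SL₂`. -/
theorem conjugateSubgroups_map_conjSL [Finite F] (hF : ScottField F) {σ : GL (Fin 2) F}
    (hσ : ¬ IsSquare (σ : Matrix (Fin 2) (Fin 2) F).det) (K : Subgroup SL(2, F))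
    [Group.IsSolvable K] (hK : ∀ k ∈ K, IsIcosahedralElement k) :
    ConjugateSubgroups K (K.map (conjSL σ).toMonoidHom) := by
  obtain ⟨n, hn, hnK⟩ := exists_conjSL_of_isSolvable hF K hK
  have hmap : K.map (conjSL n).toMonoidHom = K := by
    have : Finite SL(2, F) := Subtype.finite
    apply Subgroup.eq_of_le_of_card_ge
    · rintro _ ⟨k, hk, rfl⟩
      exact hnK k hk
    · exact (Nat.card_congr (K.equivMapOfInjective _ (conjSL n).injective).toEquiv).le
  have hdet : IsSquare ((σ * n⁻¹ : GL (Fin 2) F) : Matrix (Fin 2) (Fin 2) F).det := by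
    rw [Units.val_mul, Matrix.det_mul]
    apply isSquare_mul_of_not_isSquare hσ
    rw [Matrix.coe_units_inv, Matrix.det_nonsing_inv, Ring.inverse_eq_inv, isSquare_inv]
    exact hn
  obtain ⟨g, hg⟩ := exists_conjSL_eq_of_isSquare hdet
  refine ⟨g, ?_⟩
  have hcomp : (conjSL σ).toMonoidHom =
      (MulAut.conj g).toMonoidHom.comp (conjSL n).toMonoidHom := by
    ext1 x
    change conjSL σ x = g * conjSL n x * g⁻¹
    rw [← hg, ← MulAut.mul_apply, ← map_mul, inv_mul_cancel_right]
  rw [hcomp, ← Subgroup.map_map, hmap]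
end

/-! ### Solvable equivalence and automorphisms -/

section
variable {G : Type*} [Group G]

lemma isSolvable_map {G' : Type*} [Group G'] (f : G →* G') (K : Subgroup G)
    [Group.IsSolvable K] : Group.IsSolvable (K.map f) :=
  Group.isSolvable_of_surjective (f := f.subgroupMap K) (f.subgroupMap_surjective K)

/-- An automorphism that maps each solvable subgroup of `H` to a conjugate makes `H` and its image
solvably equivalent. -/
lemma solvablyEquivalent_map [Finite G] (φ : MulAut G) (H : Subgroup G)
    (h : ∀ K ≤ H, Group.IsSolvable K → ConjugateSubgroups K (K.map φ.toMonoidHom)) :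
    SolvablyEquivalent H (H.map φ.toMonoidHom) := by
  have hinj : Function.Injective φ.toMonoidHom := φ.injective
  refine ⟨⟨fun K => ⟨K.1.map φ.toMonoidHom, Subgroup.map_mono K.2.1, ?_⟩,
    fun L => ⟨L.1.comap φ.toMonoidHom, ?_, ?_⟩, fun K => Subtype.ext ?_, fun L => Subtype.ext ?_⟩,
    fun K => h K.1 K.2.1 K.2.2⟩
  · have := K.2.2
    exact isSolvable_map _ _
  · exact (Subgroup.comap_mono L.2.1).trans (Subgroup.comap_map_eq_self_of_injective hinj H).le
  · have := L.2.2
    exact Group.isSolvable_of_isSolvable_injective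
      (f := (φ.toMonoidHom.subgroupComap L.1))
      (fun x y hxy => Subtype.ext (hinj (congrArg Subtype.val hxy)))
  · exact Subgroup.comap_map_eq_self_of_injective hinj _
  · exact Subgroup.map_comap_eq_self_of_surjective φ.surjective _

/-- The automorphism of `G` modulo its center induced by an automorphism of `G`. -/
def centerQuotientAut (φ : MulAut G) : MulAut (G ⧸ Subgroup.center G) :=
  QuotientGroup.congr _ _ φ (Subgroup.characteristic_iff_map_eq.1 inferInstance φ)

lemma map_centerQuotientAut (φ : MulAut G) (H : Subgroup G) :
    (H.map φ.toMonoidHom).map (QuotientGroup.mk' (Subgroup.center G)) =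
      (H.map (QuotientGroup.mk' (Subgroup.center G))).map (centerQuotientAut φ).toMonoidHom := by
  rw [Subgroup.map_map, Subgroup.map_map]
  rfl

lemma conjugateSubgroups_map_mk' {H₁ H₂ : Subgroup G} (N : Subgroup G) [N.Normal]
    (h : ConjugateSubgroups H₁ H₂) :
    ConjugateSubgroups (H₁.map (QuotientGroup.mk' N)) (H₂.map (QuotientGroup.mk' N)) := by
  obtain ⟨g, rfl⟩ := h
  refine ⟨g, ?_⟩
  rw [Subgroup.map_map, Subgroup.map_map]
  rfl

lemma conjugateSubgroups_of_map_mk' {H₁ H₂ : Subgroup G} (N : Subgroup G) [N.Normal]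
    (h₁ : N ≤ H₁) (h₂ : N ≤ H₂)
    (h : ConjugateSubgroups (H₁.map (QuotientGroup.mk' N)) (H₂.map (QuotientGroup.mk' N))) :
    ConjugateSubgroups H₁ H₂ := by
  obtain ⟨g, hg⟩ := h
  obtain ⟨g, rfl⟩ := QuotientGroup.mk'_surjective N g
  refine ⟨g, ?_⟩
  have h3 : H₂.map (QuotientGroup.mk' N) =
      (H₁.map (MulAut.conj g).toMonoidHom).map (QuotientGroup.mk' N) := by
    rw [hg, Subgroup.map_map, Subgroup.map_map]
    rfl
  have hN : N ≤ H₁.map (MulAut.conj g).toMonoidHom := by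
    intro x hx
    refine ⟨g⁻¹ * x * g, h₁ ?_, ?_⟩
    · simpa using (inferInstance : N.Normal).conj_mem x hx g⁻¹
    · change g * (g⁻¹ * x * g) * g⁻¹ = x
      group
  have h4 := congrArg (Subgroup.comap (QuotientGroup.mk' N)) h3
  rwa [Subgroup.comap_map_eq_self (by rwa [QuotientGroup.ker_mk']),
    Subgroup.comap_map_eq_self (by rwa [QuotientGroup.ker_mk'])] at h4

lemma isSolvable_comap_center (K : Subgroup (G ⧸ Subgroup.center G)) [Group.IsSolvable K] :
    Group.IsSolvable (K.comap (QuotientGroup.mk' (Subgroup.center G))) := by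
  let g := (QuotientGroup.mk' (Subgroup.center G)).subgroupComap K
  have hc : Group.IsSolvable g.ker := by
    apply Group.isSolvable_of_comm
    rintro ⟨⟨a, ha⟩, ha'⟩ ⟨b, hb⟩
    have h1 : a ∈ Subgroup.center G := by
      rw [← QuotientGroup.eq_one_iff]
      exact congrArg Subtype.val ha'
    apply Subtype.ext
    apply Subtype.ext
    exact (Subgroup.mem_center_iff.1 h1 b).symm
  exact Group.isSolvable_of_ker_le_range g.ker.subtype g (by rw [Subgroup.range_subtype])

/-- Solvable equivalence of `H` with its image under an automorphism descends to the quotient by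
the center, because central extensions of solvable groups are solvable. -/
lemma solvablyEquivalent_map_center [Finite (G ⧸ Subgroup.center G)] (φ : MulAut G) (H : Subgroup G)
    (h : ∀ K ≤ H, Group.IsSolvable K → ConjugateSubgroups K (K.map φ.toMonoidHom)) :
    SolvablyEquivalent (H.map (QuotientGroup.mk' (Subgroup.center G)))
      ((H.map φ.toMonoidHom).map (QuotientGroup.mk' (Subgroup.center G))) := by
  rw [map_centerQuotientAut]
  apply solvablyEquivalent_map
  intro K hKH hK
  have hs := isSolvable_comap_center K
  obtain ⟨L, hL⟩ : ∃ L, L = K.comap (QuotientGroup.mk' (Subgroup.center G)) ⊓ H := ⟨_, rfl⟩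
  have hLK : L.map (QuotientGroup.mk' (Subgroup.center G)) = K := by
    apply le_antisymm
    · rw [Subgroup.map_le_iff_le_comap, hL]
      exact inf_le_left
    · intro x hx
      obtain ⟨y, hy, rfl⟩ := hKH hx
      rw [hL]
      exact ⟨y, ⟨hx, hy⟩, rfl⟩
  have hLs : Group.IsSolvable L := by
    have hle : L ≤ K.comap (QuotientGroup.mk' (Subgroup.center G)) := hL ▸ inf_le_left
    exact Group.isSolvable_of_isSolvable_injective (Subgroup.inclusion_injective hle)
  rw [← hLK, ← map_centerQuotientAut]
  exact conjugateSubgroups_map_mk' _ (h L (hL ▸ inf_le_right) hLs)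
end

/-! ### The normalizer of an embedded `SL₂(F₅)` -/

section
open BruhatRelations

/-- An upper unitriangular element of `SL₂(F₅)`. -/
def unitri (s : ZMod 5) : SL(2, ZMod 5) := ⟨!![1, s; 0, 1], by simp⟩

lemma coe_unitri (s : ZMod 5) :
    (unitri s : Matrix (Fin 2) (Fin 2) (ZMod 5)) = !![1, s; 0, 1] := rfl

lemma unitri_conj_unitri_one (a : ZMod 5) : unitri a * unitri 1 * (unitri a)⁻¹ = unitri 1 := by
  rw [mul_inv_eq_iff_eq_mul]
  revert a
  decide

lemma inv_map_mul_map_conj_mul {G H : Type*} [Group G] [Group H] (ρ : G →* H) (g x : G) :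
    (ρ g)⁻¹ * ρ (g * x * g⁻¹) * ρ g = ρ x := by
  simp [mul_assoc]

lemma two_ne_zero_five : (2 : ZMod 5) ≠ 0 := by decide

/-- An element of order five of `SL₂(F₅)` is conjugate to the standard unipotent or to its
square. -/
lemma exists_conj_unitri {y : SL(2, ZMod 5)} (hy : y ^ 5 = 1) (hy1 : y ≠ 1) :
    ∃ (h : SL(2, ZMod 5)) (s : ZMod 5), (s = 1 ∨ s = 2) ∧ y = h * unitri s * h⁻¹ := by
  have ht := trace_of_pow_five two_ne_zero_five hy hy1
  have hd := sl_det_eq y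
  have htr : ∀ t : ZMod 5, t ^ 2 + t - 1 = 0 → t = 2 := by decide
  have h2 := htr _ ht
  rw [sl_coe_eq y] at h2
  simp [Matrix.trace_fin_two] at h2
  have hne : ¬ (y 0 0 = 1 ∧ y 0 1 = 0 ∧ y 1 0 = 0) := by
    rintro ⟨h00, h01, h10⟩
    apply hy1
    apply sl_coe_injective
    rw [sl_coe_eq y, h00, h01, h10, show y 1 1 = 1 by rw [h00] at h2; linear_combination h2,
      Matrix.SpecialLinearGroup.coe_one, Matrix.one_fin_two]
  have key : ∀ a b c : ZMod 5, (a - 1) ^ 2 = -(b * c) → ¬ (a = 1 ∧ b = 0 ∧ c = 0) →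
      ∃ u v s : ZMod 5, (u ≠ 0 ∨ v ≠ 0) ∧ (s = 1 ∨ s = 2) ∧ s * u ^ 2 = b ∧ -(s * v ^ 2) = c ∧
        -(s * u * v) = a - 1 := by
    decide +kernel
  have hcol : ∀ u v : ZMod 5, u ≠ 0 ∨ v ≠ 0 → ∃ w z : ZMod 5, u * z - w * v = 1 := by
    decide +kernel
  obtain ⟨u, v, s, huv, hs, h01, h10, h00⟩ := key (y 0 0) (y 0 1) (y 1 0)
    (by linear_combination -hd + y 0 0 * h2) hne
  obtain ⟨w, z, hwz⟩ := hcol u v huv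
  obtain ⟨g, hg⟩ : ∃ g : SL(2, ZMod 5),
      (g : Matrix (Fin 2) (Fin 2) (ZMod 5)) = !![u, w; v, z] :=
    ⟨⟨!![u, w; v, z], by rw [Matrix.det_fin_two_of, hwz]⟩, rfl⟩
  refine ⟨g, s, hs, ?_⟩
  rw [eq_mul_inv_iff_mul_eq]
  apply sl_coe_injective
  rw [Matrix.SpecialLinearGroup.coe_mul, Matrix.SpecialLinearGroup.coe_mul, coe_unitri, hg,
    sl_coe_eq y]
  simp only [Matrix.mul_fin_two]
  have h11 : y 1 1 = 2 - y 0 0 := by linear_combination h2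
  rw [← h01, ← h10, h11, show y 0 0 = 1 - s * u * v by linear_combination -h00]
  ext i j
  fin_cases i <;> fin_cases j <;> simp
  · ring
  · linear_combination s * u * hwz
  · ring
  · linear_combination s * v * hwz

/-- An element `w` with `w² = -1` and `(x w)³ = -1`, where `x` is the standard unipotent, is
conjugate to the Weyl element by an element commuting with `x`. -/
lemma exists_conj_weyl {w : SL(2, ZMod 5)} (hw : w ^ 2 = -1) (hxw : (unitri 1 * w) ^ 3 = -1)
    (hxw1 : unitri 1 * w ≠ -1) : ∃ a, w = unitri a * weyl * (unitri a)⁻¹ := by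
  have ht := trace_eq_zero_iff.2 hw
  have h3 := trace_of_pow_three two_ne_zero_five (x := -(unitri 1 * w))
    (by rw [Odd.neg_pow (by decide), hxw, neg_neg]) (fun h => hxw1 (by rw [← h, neg_neg]))
  have hd := sl_det_eq w
  rw [trace_neg_sl, Matrix.SpecialLinearGroup.coe_mul, coe_unitri, sl_coe_eq w,
    Matrix.mul_fin_two] at h3
  rw [sl_coe_eq w] at ht
  simp [Matrix.trace_fin_two] at ht h3
  refine ⟨w 0 0, ?_⟩
  rw [eq_mul_inv_iff_mul_eq]
  apply sl_coe_injective
  rw [Matrix.SpecialLinearGroup.coe_mul, Matrix.SpecialLinearGroup.coe_mul, coe_unitri, coe_weyl,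
    sl_coe_eq w]
  simp only [Matrix.mul_fin_two]
  have h10 : w 1 0 = 1 := by linear_combination -ht - h3
  rw [h10] at hd ⊢
  ext i j
  fin_cases i <;> fin_cases j <;> simp
  · linear_combination w 0 0 * ht - hd
  · linear_combination ht

section
variable {F : Type*} [Field F]

lemma trace_conjSL (n : GL (Fin 2) F) (x : SL(2, F)) :
    ((conjSL n x : SL(2, F)) : Matrix (Fin 2) (Fin 2) F).trace =
      (x : Matrix (Fin 2) (Fin 2) F).trace := by
  change (n.1 * x.1 * n⁻¹.1).trace = _
  rw [Matrix.trace_mul_comm, ← Matrix.mul_assoc, ← Units.val_mul, inv_mul_cancel, Units.val_one,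
    Matrix.one_mul]

lemma trace_sq (x : SL(2, F)) : ((x ^ 2 : SL(2, F)) : Matrix (Fin 2) (Fin 2) F).trace =
    (x : Matrix (Fin 2) (Fin 2) F).trace ^ 2 - 2 := by
  rw [coe_sq_eq, Matrix.trace_sub, Matrix.trace_smul, Matrix.trace_one, smul_eq_mul, pow_two,
    Fintype.card_fin, Nat.cast_ofNat]

lemma eq_neg_one_of_sq (h2 : (2 : F) ≠ 0) {x : SL(2, F)} (hx : x ^ 2 = 1) (h1 : x ≠ 1) :
    x = -1 := by
  by_contra hne
  have h := coe_sq_eq x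
  rw [hx, Matrix.SpecialLinearGroup.coe_one] at h
  have h3 : (x : Matrix (Fin 2) (Fin 2) F).trace • (x : Matrix (Fin 2) (Fin 2) F) =
      (2 : F) • 1 := by
    rw [two_smul]
    exact (sub_eq_iff_eq_add.1 h.symm)
  exact h2 (eq_zero_of_smul_eq h1 hne h3).2

lemma map_neg_one_of_injective (h2 : (2 : F) ≠ 0) {ρ : SL(2, ZMod 5) →* SL(2, F)}
    (hρ : Function.Injective ρ) : ρ (-1) = -1 := by
  apply eq_neg_one_of_sq h2
  · rw [← map_pow, neg_one_sq, map_one]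
  · rw [Ne, ← map_one ρ, hρ.eq_iff]
    exact (one_ne_neg_one_SL2 two_ne_zero_five).symm

/-- A matrix normalizing an embedded `SL₂(F₅)` has square determinant. The traces of an element of
order five and of its square differ, so the induced automorphism of `SL₂(F₅)` preserves the classes
of elements of order five; it is therefore inner, and the matrix is a scalar multiple of an
element of the group. -/
theorem isSquare_det_of_normalizes (h2 : (2 : F) ≠ 0) (h5 : (5 : F) ≠ 0)
    {ρ : SL(2, ZMod 5) →* SL(2, F)} (hρ : Function.Injective ρ) {n : GL (Fin 2) F}
    (hn : ∀ k ∈ ρ.range, conjSL n k ∈ ρ.range) :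
    IsSquare (n : Matrix (Fin 2) (Fin 2) F).det := by
  -- multiplying `n` by elements of the group changes neither hypothesis nor conclusion
  have hshift : ∀ (h : SL(2, ZMod 5)) (m : GL (Fin 2) F),
      m = (Matrix.SpecialLinearGroup.toGL (ρ h))⁻¹ * n →
      (m : Matrix (Fin 2) (Fin 2) F).det = (n : Matrix (Fin 2) (Fin 2) F).det ∧
      (∀ x, conjSL m x = (ρ h)⁻¹ * conjSL n x * ρ h) := by
    rintro h m rfl
    constructor
    · rw [← map_inv, ← map_inv, Units.val_mul, Matrix.det_mul]
      change (ρ h⁻¹ : Matrix (Fin 2) (Fin 2) F).det * _ = _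
      rw [(ρ h⁻¹).2, one_mul]
    · intro x
      rw [map_mul, MulAut.mul_apply, ← map_inv, conjSL_toGL, inv_inv]
  have hneg := map_neg_one_of_injective h2 hρ
  obtain ⟨y, hy⟩ := hn (ρ (unitri 1)) ⟨_, rfl⟩
  have hx5 : unitri 1 ^ 5 = 1 := by decide
  have hx1 : unitri 1 ≠ 1 := by decide
  have hy5 : y ^ 5 = 1 := by
    apply hρ
    rw [map_pow, hy, ← map_pow, ← map_pow, hx5, map_one, map_one]
  have hy1 : y ≠ 1 := by
    rintro rfl
    rw [map_one, eq_comm, EmbeddingLike.map_eq_one_iff, ← map_one ρ] at hy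
    exact hx1 (hρ hy)
  obtain ⟨h, s, hs, rfl⟩ := exists_conj_unitri hy5 hy1
  obtain rfl : s = 1 := by
    refine hs.resolve_right ?_
    rintro rfl
    have h3 := trace_conjSL n (ρ (unitri 1))
    have h4 := trace_of_pow_five h2 (x := ρ (unitri 1)) (by rw [← map_pow, hx5, map_one])
      (fun h => hx1 (hρ (by rw [h, map_one])))
    rw [← hy, map_mul, map_mul, map_inv, trace_sl_conj, show unitri 2 = unitri 1 ^ 2 by decide,
      map_pow, trace_sq] at h3
    generalize (ρ (unitri 1) : Matrix (Fin 2) (Fin 2) F).trace = t at *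
    -- `t² + t = 1` and `t² - t = 2` force `5 = 0`
    apply h5
    linear_combination (2 * t + 1) * (h4 - h3) - 4 * h4
  obtain ⟨m, hm⟩ : ∃ m, m = (Matrix.SpecialLinearGroup.toGL (ρ h))⁻¹ * n := ⟨_, rfl⟩
  obtain ⟨hmdet, hmconj⟩ := hshift h m hm
  have hmx : conjSL m (ρ (unitri 1)) = ρ (unitri 1) := by
    rw [hmconj, ← hy, inv_map_mul_map_conj_mul]
  obtain ⟨w, hw⟩ : ∃ w, ρ w = conjSL m (ρ weyl) := by
    obtain ⟨k, hk⟩ := hn (ρ weyl) ⟨_, rfl⟩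
    exact ⟨h⁻¹ * k * h, by rw [hmconj, ← hk, map_mul, map_mul, map_inv]⟩
  have hw2 : w ^ 2 = -1 := by
    apply hρ
    rw [map_pow, hw, ← map_pow, ← map_pow, show weyl ^ 2 = -1 by decide, hneg, conjSL_neg_one]
  have hxw : ρ (unitri 1 * w) = conjSL m (ρ (unitri 1 * weyl)) := by
    rw [map_mul, hw, map_mul, map_mul, hmx]
  have hxw3 : (unitri 1 * w) ^ 3 = -1 := by
    apply hρ
    rw [map_pow, hxw, ← map_pow, ← map_pow, show (unitri 1 * weyl) ^ 3 = -1 by decide, hneg,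
      conjSL_neg_one]
  have hxw1 : unitri 1 * w ≠ -1 := by
    intro h1
    rw [h1, hneg, ← conjSL_neg_one m, ← hneg, (conjSL m).injective.eq_iff, hρ.eq_iff] at hxw
    exact absurd hxw (by decide)
  obtain ⟨a, ha⟩ := exists_conj_weyl hw2 hxw3 hxw1
  obtain ⟨N, hN⟩ : ∃ N, N = (Matrix.SpecialLinearGroup.toGL (ρ (h * unitri a)))⁻¹ * n := ⟨_, rfl⟩
  obtain ⟨hNdet, hNconj⟩ := hshift _ N hN
  have hNm : ∀ x, conjSL N x = (ρ (unitri a))⁻¹ * conjSL m x * ρ (unitri a) := by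
    intro x
    rw [hNconj, hmconj, map_mul]
    group
  have hNx : conjSL N (ρ (unitri 1)) = ρ (unitri 1) := by
    rw [hNm, hmx]
    conv_lhs => rw [← unitri_conj_unitri_one a]
    rw [inv_map_mul_map_conj_mul]
  have hNw : conjSL N (ρ weyl) = ρ weyl := by
    rw [hNm, ← hw, ha, inv_map_mul_map_conj_mul]
  rw [conjSL_eq_iff] at hNx hNw
  have hr1 : ρ (unitri 1) ≠ 1 := fun h => hx1 (hρ (by rw [h, map_one]))
  have hr2 : ρ (unitri 1) ≠ -1 := by
    rw [← hneg, Ne, hρ.eq_iff]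
    decide
  obtain ⟨α, β, hαβ⟩ := exists_eq_add_smul_of_commute hr1 hr2 hNx.symm
  have hβ : β = 0 := by
    by_contra hβ
    rw [hαβ, Matrix.add_mul, Matrix.mul_add, Matrix.smul_mul, Matrix.smul_mul, Matrix.mul_smul,
      Matrix.mul_smul, Matrix.one_mul, Matrix.mul_one, add_right_inj,
      (smul_right_injective _ hβ).eq_iff, ← Matrix.SpecialLinearGroup.coe_mul,
      ← Matrix.SpecialLinearGroup.coe_mul] at hNw
    have h3 := hρ (by rw [map_mul, map_mul]; exact sl_coe_injective hNw :
      ρ (unitri 1 * weyl) = ρ (weyl * unitri 1))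
    exact absurd h3 (by decide)
  refine ⟨α, ?_⟩
  rw [← hNdet, hαβ, hβ, zero_smul, add_zero, Matrix.det_smul, Matrix.det_one, Fintype.card_fin]
  ring
end

end

/-! ### Scott's pairs of subgroups -/

lemma scottField_zmod {p : ℕ} [Fact p.Prime] (hp : p % 120 = 29 ∨ p % 120 = 91) :
    ScottField (ZMod p) where
  two := two_not_isSquare hp
  three := three_not_isSquare hp
  five _ ht := two_sub_golden_root_not_isSquare hp ht
  five_ne_zero := by exact_mod_cast natCast_ne_zero_of_lt (p := p) (n := 5) (by omega) (by omega)

/-- Every element of `SL₂(F₅)` is icosahedral, by the list of its possible traces. -/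
lemma isIcosahedralElement_SL2_five (g : SL(2, ZMod 5)) : IsIcosahedralElement g := by
  have h3 := coe_pow_three_eq g
  have h5 := coe_pow_five_eq g
  have h2 := coe_sq_eq g
  unfold IsIcosahedralElement
  generalize (g : Matrix (Fin 2) (Fin 2) (ZMod 5)).trace = t at *
  have ht : ∀ t : ZMod 5, t = 0 ∨ t = 1 ∨ t = -1 ∨ t = 2 ∨ t = -2 := by decide
  rcases ht t with rfl | rfl | rfl | rfl | rfl
  · right; right; left
    apply sl_coe_injective
    rw [h2]; simp
  · right; right; right; right; left
    apply sl_coe_injective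
    rw [h3]; simp
  · right; right; right; left
    apply sl_coe_injective
    rw [h3]; simp
  · right; right; right; right; right; left
    apply sl_coe_injective
    rw [h5, show ((2 : ZMod 5) ^ 4 - 3 * 2 ^ 2 + 1) = 0 by decide,
      show ((2 : ZMod 5) ^ 3 - 2 * 2) = -1 by decide]
    simp
  · right; right; right; right; right; right
    apply sl_coe_injective
    rw [h5, show ((-2 : ZMod 5) ^ 4 - 3 * (-2) ^ 2 + 1) = 0 by decide,
      show ((-2 : ZMod 5) ^ 3 - 2 * (-2)) = 1 by decide]
    simp

section
variable {F : Type*} [Field F]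

lemma IsIcosahedralElement.map_of_injective (h2 : (2 : F) ≠ 0) {ρ : SL(2, ZMod 5) →* SL(2, F)}
    (hρ : Function.Injective ρ) {g : SL(2, ZMod 5)} (hg : IsIcosahedralElement g) :
    IsIcosahedralElement (ρ g) := by
  have hneg := map_neg_one_of_injective h2 hρ
  unfold IsIcosahedralElement at hg ⊢
  simp only [← map_pow]
  rcases hg with h | h | h | h | h | h | h <;> rw [h] <;> simp [hneg]

/-- The image in `PSL₂` of an embedded `SL₂(F₅)` is isomorphic to `A₅`. -/
lemma nonempty_map_mk'_mulEquiv_alternatingGroup (h2 : (2 : F) ≠ 0)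
    {ρ : SL(2, ZMod 5) →* SL(2, F)} (hρ : Function.Injective ρ) :
    Nonempty (ρ.range.map (QuotientGroup.mk' (Subgroup.center SL(2, F))) ≃*
      alternatingGroup (Fin 5)) := by
  obtain ⟨f, hf, hker⟩ := exists_hom_alternatingGroup
  have hneg := map_neg_one_of_injective h2 hρ
  have hk : ((QuotientGroup.mk' (Subgroup.center SL(2, F))).comp ρ).ker = f.ker := by
    ext g
    rw [MonoidHom.mem_ker, MonoidHom.mem_ker, hker, MonoidHom.comp_apply, QuotientGroup.mk'_apply,
      QuotientGroup.eq_one_iff, mem_center_SL2_iff, ← hneg, hρ.eq_iff, ← map_one ρ, hρ.eq_iff]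
  rw [MonoidHom.map_range]
  exact ⟨(QuotientGroup.quotientKerEquivRange _).symm.trans
    ((QuotientGroup.quotientMulEquivOfEq hk).trans
      (QuotientGroup.quotientKerEquivOfSurjective f hf))⟩

end

theorem theorem3p5 :
    (∀ (p : ℕ) [Fact p.Prime],
      ((p : ℤ) ≡ 29 [ZMOD 120] ∨ (p : ℤ) ≡ -29 [ZMOD 120]) →
      ∃ (H₁ H₂ : Subgroup (Matrix.SpecialLinearGroup (Fin 2) (ZMod p)))
        (r : ZMod p) (σ : Matrix.GeneralLinearGroup (Fin 2) (ZMod p)),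
        ¬ IsSquare r ∧
        (σ : Matrix (Fin 2) (Fin 2) (ZMod p)) = !![r, 0; 0, 1] ∧
        H₂.map Matrix.SpecialLinearGroup.toGL =
          (H₁.map Matrix.SpecialLinearGroup.toGL).map (MulAut.conj σ).toMonoidHom ∧
        Nonempty (H₁ ≃* Matrix.SpecialLinearGroup (Fin 2) (ZMod 5)) ∧
        Nonempty (H₂ ≃* Matrix.SpecialLinearGroup (Fin 2) (ZMod 5)) ∧
        ¬ ConjugateSubgroups H₁ H₂ ∧
        SolvablyEquivalent H₁ H₂ ∧
        Nonempty (projectiveImage H₁ ≃* alternatingGroup (Fin 5)) ∧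
        Nonempty (projectiveImage H₂ ≃* alternatingGroup (Fin 5)) ∧
        ¬ ConjugateSubgroups (projectiveImage H₁) (projectiveImage H₂) ∧
        SolvablyEquivalent (projectiveImage H₁) (projectiveImage H₂)) ∧
    29 ∈ scottPrimes ∧
    scottPrimes.Infinite ∧
    (∀ p ∈ scottPrimes, ∀ q ∈ scottPrimes, p ≠ q →
      IsEmpty (Matrix.SpecialLinearGroup (Fin 2) (ZMod p) ≃*
        Matrix.SpecialLinearGroup (Fin 2) (ZMod q)) ∧
      IsEmpty (Matrix.ProjectiveSpecialLinearGroup (Fin 2) (ZMod p) ≃*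
        Matrix.ProjectiveSpecialLinearGroup (Fin 2) (ZMod q))) := by
  refine ⟨fun p _ hmod => ?_, ⟨by norm_num, Or.inl rfl⟩, infinite_scottPrimes, ?_⟩
  · -- the nonsquare is `r = 2`
    have hp := scott_mod hmod
    have hF := scottField_zmod hp
    have h2 := hF.two_ne_zero
    obtain ⟨ρ, hρ⟩ := exists_hom_SL2_five hp
    have hdet : (!![2, 0; 0, 1] : Matrix (Fin 2) (Fin 2) (ZMod p)).det = 2 := by
      rw [Matrix.det_fin_two_of]; ring
    obtain ⟨σ, hσ⟩ : ∃ σ : GL (Fin 2) (ZMod p),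
        (σ : Matrix (Fin 2) (Fin 2) (ZMod p)) = !![2, 0; 0, 1] :=
      ⟨Matrix.GeneralLinearGroup.mkOfDetNeZero _ (by rw [hdet]; exact h2), rfl⟩
    have hσdet : ¬ IsSquare (σ : Matrix (Fin 2) (Fin 2) (ZMod p)).det := by
      rw [hσ, hdet]; exact hF.two
    have hconj : ∀ K ≤ ρ.range, Group.IsSolvable K →
        ConjugateSubgroups K (K.map (conjSL σ).toMonoidHom) := by
      intro K hKH hK
      refine conjugateSubgroups_map_conjSL hF hσdet K fun k hk => ?_
      obtain ⟨g, rfl⟩ := hKH hk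
      exact (isIcosahedralElement_SL2_five g).map_of_injective h2 hρ
    have hnot : ¬ ConjugateSubgroups ρ.range (ρ.range.map (conjSL σ).toMonoidHom) := by
      rintro ⟨g, hg⟩
      apply hσdet
      have hsq := isSquare_det_of_normalizes h2 hF.five_ne_zero hρ
        (n := Matrix.SpecialLinearGroup.toGL g⁻¹ * σ) ?_
      · rw [Units.val_mul, Matrix.det_mul] at hsq
        change IsSquare ((g⁻¹ : Matrix.SpecialLinearGroup (Fin 2) (ZMod p)).1.det * _) at hsq
        rwa [(g⁻¹).2, one_mul] at hsq
      · intro k hk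
        have h3 : conjSL σ k ∈ ρ.range.map (conjSL σ).toMonoidHom := ⟨k, hk, rfl⟩
        rw [hg] at h3
        obtain ⟨l, hl, hlk⟩ := h3
        change g * l * g⁻¹ = conjSL σ k at hlk
        rw [map_mul, MulAut.mul_apply, conjSL_toGL, ← hlk]
        simpa [mul_assoc] using hl
    have hcenter : Subgroup.center SL(2, ZMod p) ≤ ρ.range := by
      intro z hz
      rcases mem_center_SL2_iff.1 hz with rfl | rfl
      · exact one_mem _
      · exact ⟨-1, map_neg_one_of_injective h2 hρ⟩
    have hcenter' : Subgroup.center SL(2, ZMod p) ≤ ρ.range.map (conjSL σ).toMonoidHom := by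
      rw [← Subgroup.characteristic_iff_map_eq.1
        (inferInstance : (Subgroup.center SL(2, ZMod p)).Characteristic) (conjSL σ)]
      exact Subgroup.map_mono hcenter
    have hA5 := nonempty_map_mk'_mulEquiv_alternatingGroup h2 hρ
    refine ⟨ρ.range, ρ.range.map (conjSL σ).toMonoidHom, 2, σ, hF.two, hσ, ?_,
      ⟨(MonoidHom.ofInjective hρ).symm⟩,
      ⟨(ρ.range.equivMapOfInjective _ (conjSL σ).injective).symm.trans
        (MonoidHom.ofInjective hρ).symm⟩,
      hnot, solvablyEquivalent_map _ _ hconj, hA5, ?_,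
      fun h => hnot (conjugateSubgroups_of_map_mk' _ hcenter hcenter' h),
      solvablyEquivalent_map_center _ _ hconj⟩
    · rw [Subgroup.map_map, Subgroup.map_map]
      congr 1
      ext1 g
      exact toGL_conjSL σ g
    · obtain ⟨e⟩ := hA5
      unfold projectiveImage
      rw [map_centerQuotientAut]
      exact ⟨(Subgroup.equivMapOfInjective _ _ (centerQuotientAut (conjSL σ)).injective).symm.trans
        e⟩
  · rintro p ⟨hp, hpm⟩ q ⟨hq, hqm⟩ hpq
    have := Fact.mk hp
    have := Fact.mk hq
    have hp' := scott_mod hpm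
    have hq' := scott_mod hqm
    exact ⟨isEmpty_SL2_mulEquiv hpq, isEmpty_PSL2_mulEquiv (by omega) (by omega) hpq⟩
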